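/- Let $R$ be a commutative unital ring, $G$ a group, and $V$ a representation of $G$ over $R$ that is free and finitely generated as an $R$-module, with basis $\mathcal{B}$. Let $\lambda$ be a partition of $n$, with conjugate $\lambda'$ and Young diagram $Y$. A tableau is a function $t\colon Y\to\mathcal{B}$, identified with the corresponding pure tensor in $V^{\otimes n}=V^{\otimes Y}$; permutations of $Y$ act on tableaux and tensors on the right by permuting boxes, $(t\cdot\sigma)(y)=t(y\sigma^{-1})$. Let $\mathrm{RPP}$ and $\mathrm{CPP}$ be the groups of permutations of $Y$ preserving each row, respectively each column; write $t\sim_{\mathrm r}u$ if $u=t\cdot\sigma$ for some $\sigma\in\mathrm{RPP}$, and let $\mathrm{RStab}(t)$ be the stabiliser of $t$ in $\mathrm{RPP}$. Write $\mathrm{Sym}^\lambda(V)=\bigotimes_i\mathrm{Sym}^{\lambda_i}V$ and $\Lambda^{\lambda'}(V)=\bigotimes_j\Lambda^{\lambda'_j}V$, let $\{t\}\in\mathrm{Sym}^\lambda(V)$ and $|t|\in\Lambda^{\lambda'}(V)$ be the images of $t$ (the row tabloid and the alternating column tabloid of $t$), and let $\mathrm{Sym}_\lambda(V)\subseteq V^{\otimes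 n}$ be the submodule of tensors invariant under $\mathrm{RPP}$. The Schur endofunctor $\nabla^\lambda(V)\subseteq\mathrm{Sym}^\lambda(V)$ is the span of the polytabloids $\sum_{\sigma\in\mathrm{CPP}}\operatorname{sgn}(\sigma)\{t\cdot\sigma\}$, and the Weyl endofunctor is $\Delta^\lambda(V)=(\nabla^\lambda(V^*))^*$. Put $$\operatorname{rsym}(t)=\sum_{u\sim_{\mathrm r}t}u\in\mathrm{Sym}_\lambda(V),\qquad c(t)=\sum_{u\sim_{\mathrm r}t}|u|\in\Lambda^{\lambda'}(V),$$ the sums running over the distinct tableaux $u$ row equivalent to $t$. The $c(t)$ are the copolytabloids, and $\mathsf{copolytab}^\lambda(V)\subseteq\Lambda^{\lambda'}(V)$ is their $R$-span. The space of dual Garnir relations $\mathsf{D}^\lambda(V)\subseteq\mathrm{Sym}_\lambda(V)$ is the $R$-span of the elements $$\sum_{u}\bigl|\mathrm{RStab}(u):\mathrm{RStab}(u)\cap(S_{A\sqcup B}\times S_{Y\setminus (A\sqcup B)})\bigr|\,\operatorname{rsym}(u),$$ where $t$ is a tableau, $A$ and $B$ are sets of boxes in rows $i<i'$ respectively with $|A|+|B|>\lambda_i$,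 and $u$ runs over a set of representatives, modulo $\sim_{\mathrm r}$, of the set of tableaux $\{t\cdot\tau:\tau\in S_{A\sqcup B}\}$. Then $\mathsf{copolytab}^\lambda(V)$ and $\mathsf{D}^\lambda(V)$ are $G$-stable, and there are isomorphisms of representations of $G$ over $R$ $$\Delta^\lambda(V)\;\cong\;\mathsf{copolytab}^\lambda(V)\;\cong\;\mathrm{Sym}_\lambda(V)/\mathsf{D}^\lambda(V).$$ Moreover the isomorphisms can be chosen so that, for every tableau $t$, the first sends the restriction to $\nabla^\lambda(V^*)$ of the functional $\{t^*\}^*$ on $\mathrm{Sym}^\lambda(V^*)$ to $c(t)$, where $\{t^*\}^*$ takes the value $1$ on $\{s^*\}$ if $s\sim_{\mathrm r}t$ and $0$ on $\{s^*\}$ for every other tableau $s$ (here $s^*$ is $s$ with each entry replaced by its dual basis vector), and the second sends $c(t)$ to the class of $\operatorname{rsym}(t)$. -/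

import Mathlib

open Module
open scoped TensorProduct

noncomputable section

namespace WeylModel

/-! ### Tableaux and place permutations

Partitions are encoded by their Young diagrams; rows and columns are indexed from `0`.  The box in
row `i` and column `j` is `(i, j)`, `μ.rowLen i` is the `i`-th part of the partition and
`μ.colLen j` is the `j`-th part of the conjugate partition. -/

/-- Tableaux of shape `μ` with entries in `X`: arbitrary functions on the set of boxes. -/
abbrev Tableau (μ : YoungDiagram) (X : Type*) : Type _ := μ.cells → X

section Tableaux

variable {μ : YoungDiagram} {X : Type*}

/-- The place permutation action `(t · σ)(b) = t(σ⁻¹ b)`. -/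
def Tableau.permute (t : Tableau μ X) (σ : Equiv.Perm μ.cells) : Tableau μ X :=
  fun b => t (σ⁻¹ b)

variable (μ) in
/-- The group of row-preserving place permutations. -/
def rowPerms : Subgroup (Equiv.Perm μ.cells) where
  carrier := {σ | ∀ b, (σ b).1.1 = b.1.1}
  mul_mem' {σ τ} hσ hτ b := (hσ (τ b)).trans (hτ b)
  one_mem' _ := rfl
  inv_mem' {σ} hσ b := by simpa using (hσ (σ⁻¹ b)).symm

variable (μ) in
/-- The group of column-preserving place permutations. -/
def colPerms : Subgroup (Equiv.Perm μ.cells) where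
  carrier := {σ | ∀ b, (σ b).1.2 = b.1.2}
  mul_mem' {σ τ} hσ hτ b := (hσ (τ b)).trans (hτ b)
  one_mem' _ := rfl
  inv_mem' {σ} hσ b := by simpa using (hσ (σ⁻¹ b)).symm

instance : DecidablePred (· ∈ rowPerms μ) := fun σ =>
  inferInstanceAs (Decidable (∀ b, (σ b).1.1 = b.1.1))

instance : DecidablePred (· ∈ colPerms μ) := fun σ =>
  inferInstanceAs (Decidable (∀ b, (σ b).1.2 = b.1.2))

/-- The stabiliser of a tableau in the group of row-preserving place permutations. -/
def rowStab (t : Tableau μ X) : Subgroup (Equiv.Perm μ.cells) where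
  carrier := {σ | σ ∈ rowPerms μ ∧ ∀ b, t (σ b) = t b}
  mul_mem' {σ τ} hσ hτ :=
    ⟨mul_mem hσ.1 hτ.1, fun b => (hσ.2 (τ b)).trans (hτ.2 b)⟩
  one_mem' := ⟨one_mem _, fun _ => rfl⟩
  inv_mem' {σ} hσ := ⟨inv_mem hσ.1, fun b => by simpa using (hσ.2 (σ⁻¹ b)).symm⟩

/-- For a set `C` of boxes, the group of place permutations that preserve both `C` and its
complement, that is, the product of the symmetric groups of `C` and of its complement. -/
def blockPerms (C : Finset μ.cells) : Subgroup (Equiv.Perm μ.cells) where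
  carrier := {σ | ∀ b, σ b ∈ C ↔ b ∈ C}
  mul_mem' {σ τ} hσ hτ b := (hσ (τ b)).trans (hτ b)
  one_mem' _ := Iff.rfl
  inv_mem' {σ} hσ b := by simpa using (hσ (σ⁻¹ b)).symm

/-- The set (without multiplicities) of the tableaux `t · τ` with `τ` a row-preserving place
permutation.  The map `τ ↦ t · τ` identifies it with the set of right cosets of `rowStab t` in
`rowPerms μ`, so that a sum over coset representatives is a sum over this set. -/
def rowOrbit [DecidableEq X] (t : Tableau μ X) : Finset (Tableau μ X) :=
  (Finset.univ.filter (· ∈ rowPerms μ)).image t.permute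

/-- Two tableaux are row equivalent if they differ by a row-preserving place permutation. -/
def RowEquiv (t u : Tableau μ X) : Prop := ∃ σ ∈ rowPerms μ, u = t.permute σ

/-- The set (without multiplicities) of the tableaux `t · τ` with `τ` a permutation of the set of
boxes `C`, all other boxes being fixed. -/
def blockOrbit (t : Tableau μ X) (C : Finset μ.cells) : Set (Tableau μ X) :=
  {u | ∃ τ : Equiv.Perm μ.cells, (∀ b ∉ C, τ b = b) ∧ u = t.permute τ}

/-- `T` is a set of representatives in `S` for the row equivalence classes that meet `S`. -/
def IsRowTransversal (S : Set (Tableau μ X)) (T : Finset (Tableau μ X)) : Prop :=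
  (∀ u ∈ T, u ∈ S) ∧ ∀ u ∈ S, ∃! v, v ∈ T ∧ RowEquiv u v

lemma mem_rowOrbit [DecidableEq X] {t u : Tableau μ X} : u ∈ rowOrbit t ↔ RowEquiv t u := by
  simp [rowOrbit, RowEquiv, eq_comm]

end Tableaux

section Powers

variable (R : Type*) [CommRing R] {G : Type*} [Group G]
  (V : Type*) [AddCommGroup V] [Module R V]

/-- The (upper) symmetric power: the quotient of the tensor power by all `w · σ - w`. -/
abbrev SymPow (n : ℕ) : Type _ :=
  (⨂[R] _ : Fin n, V) ⧸ Submodule.span R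
    {x | ∃ (w : ⨂[R] _ : Fin n, V) (σ : Equiv.Perm (Fin n)),
      x = PiTensorProduct.reindex R (fun _ => V) σ w - w}

/-- `Sym^λ V`, the tensor product over the rows of the symmetric powers `Sym^{λ_i} V`. -/
abbrev SymUpper (μ : YoungDiagram) : Type _ :=
  ⨂[R] i : Fin (μ.colLen 0), SymPow R V (μ.rowLen i)

/-- `Λ^{λ'} V`, the tensor product over the columns of the exterior powers `Λ^{λ'_j} V`. -/
abbrev ExtUpper (μ : YoungDiagram) : Type _ :=
  ⨂[R] j : Fin (μ.rowLen 0), ⋀[R]^(μ.colLen j) V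

/-- `Sym_λ V`, the space of those tensors in `V^{⊗ |λ|}`, with tensor factors labelled by the boxes
of the diagram, that are symmetric along each row. -/
def SymLower (μ : YoungDiagram) : Submodule R (⨂[R] _ : μ.cells, V) where
  carrier := {w | ∀ σ ∈ rowPerms μ, PiTensorProduct.reindex R (fun _ => V) σ w = w}
  add_mem' hv hw σ hσ := by rw [map_add, hv σ hσ, hw σ hσ]
  zero_mem' _ _ := map_zero _
  smul_mem' c w hw σ hσ := by rw [map_smul, hw σ hσ]

variable {V}

/-- The action of a group on a tensor product of representations. -/
def piTensorRep {I : Type*} {M : I → Type*} [∀ i, AddCommGroup (M i)] [∀ i, Module R (M i)]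
    (σ : ∀ i, Representation R G (M i)) : Representation R G (⨂[R] i, M i) :=
  PiTensorProduct.mapMonoidHom.comp (MonoidHom.pi σ)

@[simp] lemma piTensorRep_tprod {I : Type*} {M : I → Type*} [∀ i, AddCommGroup (M i)]
    [∀ i, Module R (M i)] (σ : ∀ i, Representation R G (M i)) (g : G) (x : ∀ i, M i) :
    piTensorRep R σ g (PiTensorProduct.tprod R x) = PiTensorProduct.tprod R fun i => σ i g (x i) :=
  PiTensorProduct.map_tprod _ _

lemma piTensorRep_reindex {I J : Type*} (ρ : Representation R G V) (e : I ≃ J) (g : G)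
    (w : ⨂[R] _ : I, V) :
    piTensorRep R (fun _ => ρ) g (PiTensorProduct.reindex R (fun _ => V) e w) =
      PiTensorProduct.reindex R (fun _ => V) e (piTensorRep R (fun _ => ρ) g w) :=
  PiTensorProduct.map_reindex (fun _ => ρ g) e w

variable (ρ : Representation R G V)

/-- The action of the group on an exterior power. -/
def extPowRep (n : ℕ) : Representation R G (⋀[R]^n V) where
  toFun g := exteriorPower.map n (ρ g)
  map_one' := by rw [map_one, Module.End.one_eq_id, exteriorPower.map_id]; rfl
  map_mul' g h := by rw [map_mul, Module.End.mul_eq_comp, exteriorPower.map_comp]; rfl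

/-- The action of the group on a symmetric power. -/
def symPowRep (n : ℕ) : Representation R G (SymPow R V n) :=
  (piTensorRep R (fun _ : Fin n => ρ)).quotient _ fun g => by
    rw [Submodule.span_le]
    rintro _ ⟨w, σ, rfl⟩
    refine Submodule.subset_span ⟨piTensorRep R (fun _ => ρ) g w, σ, ?_⟩
    rw [map_sub, piTensorRep_reindex]

/-- The action of the group on `Sym^λ V`. -/
def symUpperRep (μ : YoungDiagram) : Representation R G (SymUpper R V μ) :=
  piTensorRep R fun i => symPowRep R ρ (μ.rowLen i)

/-- The action of the group on `Λ^{λ'} V`. -/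
def extUpperRep (μ : YoungDiagram) : Representation R G (ExtUpper R V μ) :=
  piTensorRep R fun j => extPowRep R ρ (μ.colLen j)

/-- The action of the group on `Sym_λ V`, restricted from the diagonal action on tensors. -/
def symLowerRep (μ : YoungDiagram) : Representation R G (SymLower R V μ) :=
  Subrepresentation.toRepresentation (ρ := piTensorRep R fun _ : μ.cells => ρ)
    { toSubmodule := SymLower R V μ
      apply_mem_toSubmodule := fun g w hw σ hσ => by
        rw [← piTensorRep_reindex, hw σ hσ] }

/-- The row tabloid of a tableau whose entries are vectors: its image under the quotient map
`V^{⊗ |λ|} → Sym^λ V`. -/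
def rowTabloid {μ : YoungDiagram} (t : Tableau μ V) : SymUpper R V μ :=
  PiTensorProduct.tprod R fun i : Fin (μ.colLen 0) =>
    (Submodule.Quotient.mk (PiTensorProduct.tprod R fun j : Fin (μ.rowLen i) =>
      t ⟨(i, j), μ.mem_iff_lt_rowLen.2 j.2⟩) : SymPow R V (μ.rowLen i))

/-- The alternating column tabloid of a tableau whose entries are vectors: its image under the
quotient map `V^{⊗ |λ|} → Λ^{λ'} V`. -/
def colTabloid {μ : YoungDiagram} (t : Tableau μ V) : ExtUpper R V μ :=
  PiTensorProduct.tprod R fun j : Fin (μ.rowLen 0) =>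
    exteriorPower.ιMulti R (μ.colLen j) fun i : Fin (μ.colLen j) =>
      t ⟨(i, j), μ.mem_iff_lt_colLen.2 i.2⟩

/-- The polytabloid `∑_{σ ∈ CPP(λ)} sgn(σ) {t · σ}` of a tableau whose entries are vectors. -/
def polytabloid {μ : YoungDiagram} (t : Tableau μ V) : SymUpper R V μ :=
  ∑ σ : Equiv.Perm μ.cells with σ ∈ colPerms μ,
    ((Equiv.Perm.sign σ : ℤ) : R) • rowTabloid R (t.permute σ)

lemma symUpperRep_rowTabloid {μ : YoungDiagram} (g : G) (t : Tableau μ V) :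
    symUpperRep R ρ μ g (rowTabloid R t) = rowTabloid R fun b => ρ g (t b) := by
  rw [symUpperRep, rowTabloid, piTensorRep_tprod, rowTabloid]
  congr 1
  funext i
  exact congrArg Submodule.Quotient.mk (piTensorRep_tprod R _ g _)

/-- The factor of a row tabloid that comes from row `i`. -/
def rowEntry {μ : YoungDiagram} (t : Tableau μ V) (i : Fin (μ.colLen 0)) :
    SymPow R V (μ.rowLen i) :=
  Submodule.Quotient.mk (PiTensorProduct.tprod R fun j : Fin (μ.rowLen i) =>
    t ⟨(i, j), μ.mem_iff_lt_rowLen.2 j.2⟩)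

lemma rowEntry_update {μ : YoungDiagram} [DecidableEq μ.cells] (t : Tableau μ V) (c : μ.cells)
    (x : V) (i : Fin (μ.colLen 0)) (hc : (i : ℕ) = c.1.1) :
    rowEntry R (Function.update t c x) i =
      Submodule.Quotient.mk (PiTensorProduct.tprod R (Function.update
        (fun j : Fin (μ.rowLen i) => t ⟨(i, j), μ.mem_iff_lt_rowLen.2 j.2⟩)
        ⟨c.1.2, by rw [hc]; exact μ.mem_iff_lt_rowLen.1 c.2⟩ x)) := by
  rw [rowEntry]
  congr 2
  funext j
  by_cases h : (j : ℕ) = c.1.2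
  · have h1 : (⟨(i, j), μ.mem_iff_lt_rowLen.2 j.2⟩ : μ.cells) = c := Subtype.ext (Prod.ext hc h)
    have h2 : j = ⟨c.1.2, by rw [hc]; exact μ.mem_iff_lt_rowLen.1 c.2⟩ := Fin.ext h
    rw [h1, Function.update_self, h2, Function.update_self]
  · rw [Function.update_of_ne, Function.update_of_ne]
    · exact fun h' => h (congrArg Fin.val h')
    · exact fun h' => h (congrArg (fun d : μ.cells => d.1.2) h')

lemma rowTabloid_update {μ : YoungDiagram} [DecidableEq μ.cells] (t : Tableau μ V) (c : μ.cells)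
    (x : V) (i : Fin (μ.colLen 0)) (hc : (i : ℕ) = c.1.1) :
    rowTabloid R (Function.update t c x) =
      PiTensorProduct.tprod R (Function.update (rowEntry R t) i
        (rowEntry R (Function.update t c x) i)) := by
  rw [rowTabloid]
  congr 1
  funext k
  change rowEntry R (Function.update t c x) k = _
  by_cases h : k = i
  · subst h; rw [Function.update_self]
  · rw [Function.update_of_ne h, rowEntry, rowEntry]
    congr 2
    funext j
    rw [Function.update_of_ne]
    exact fun h' => h (Fin.ext ((congrArg (fun d : μ.cells => d.1.1) h').trans hc.symm))

/-- The Schur endofunctor in its model as a subspace of a symmetric power: the span of the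
polytabloids in `Sym^λ V`.  By multilinearity it is also spanned by the polytabloids of the tableaux
with entries in any fixed basis of `V`, see `polytab_eq_span_basis`. -/
def polytab (μ : YoungDiagram) : Subrepresentation (symUpperRep R ρ μ) where
  toSubmodule := Submodule.span R (Set.range fun t : Tableau μ V => polytabloid R t)
  apply_mem_toSubmodule g := by
    suffices h : Submodule.span R (Set.range fun t : Tableau μ V => polytabloid R t) ≤
        (Submodule.span R (Set.range fun t : Tableau μ V => polytabloid R t)).comap
          (symUpperRep R ρ μ g) from fun _ hv => h hv
    rw [Submodule.span_le]
    rintro _ ⟨t, rfl⟩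
    refine Submodule.subset_span ⟨fun b => ρ g (t b), ?_⟩
    simp only [polytabloid, map_sum, map_smul, symUpperRep_rowTabloid]
    rfl

/-- Row tabloids are multilinear in the entries of the tableau. -/
def rowTabloidMultilinear (μ : YoungDiagram) :
    MultilinearMap R (fun _ : μ.cells => V) (SymUpper R V μ) :=
  MultilinearMap.mk' (fun t => rowTabloid R t)
    (fun t c x y => by
      obtain ⟨i, hc⟩ : ∃ i : Fin (μ.colLen 0), (i : ℕ) = c.1.1 :=
        ⟨⟨c.1.1, μ.mem_iff_lt_colLen.1 (μ.up_left_mem le_rfl (Nat.zero_le _) c.2)⟩, rfl⟩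
      rw [rowTabloid_update R t c _ i hc, rowTabloid_update R t c _ i hc,
        rowTabloid_update R t c _ i hc, rowEntry_update R t c _ i hc, rowEntry_update R t c _ i hc,
        rowEntry_update R t c _ i hc, MultilinearMap.map_update_add, Submodule.Quotient.mk_add,
        MultilinearMap.map_update_add])
    (fun t c a x => by
      obtain ⟨i, hc⟩ : ∃ i : Fin (μ.colLen 0), (i : ℕ) = c.1.1 :=
        ⟨⟨c.1.1, μ.mem_iff_lt_colLen.1 (μ.up_left_mem le_rfl (Nat.zero_le _) c.2)⟩, rfl⟩
      rw [rowTabloid_update R t c _ i hc, rowTabloid_update R t c _ i hc,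
        rowEntry_update R t c _ i hc, rowEntry_update R t c _ i hc,
        MultilinearMap.map_update_smul, Submodule.Quotient.mk_smul,
        MultilinearMap.map_update_smul])

/-- The polytabloids of the tableaux with entries in a fixed basis already span. -/
lemma polytab_eq_span_basis {ι : Type*} (b : Basis ι R V) (μ : YoungDiagram) :
    (polytab R ρ μ).toSubmodule =
      Submodule.span R (Set.range fun t : Tableau μ ι => polytabloid R (b ∘ t)) := by
  let L : (⨂[R] _ : μ.cells, V) →ₗ[R] SymUpper R V μ :=
    ∑ σ : Equiv.Perm μ.cells with σ ∈ colPerms μ, ((Equiv.Perm.sign σ : ℤ) : R) •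
      (PiTensorProduct.lift (rowTabloidMultilinear R μ) ∘ₗ
        (PiTensorProduct.reindex R (fun _ => V) σ).toLinearMap)
  have hL (t : Tableau μ V) : L (PiTensorProduct.tprod R t) = polytabloid R t := by
    simp only [L, LinearMap.sum_apply, LinearMap.smul_apply, LinearMap.comp_apply,
      LinearEquiv.coe_coe, PiTensorProduct.reindex_tprod, PiTensorProduct.lift.tprod, polytabloid]
    rfl
  have h1 : (polytab R ρ μ).toSubmodule = (⊤ : Submodule R (⨂[R] _ : μ.cells, V)).map L := by
    rw [← PiTensorProduct.span_tprod_eq_top, Submodule.map_span, ← Set.range_comp]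
    exact congrArg (fun f => Submodule.span R (Set.range f)) (funext fun t => (hL t).symm)
  rw [h1, ← (Basis.piTensorProduct fun _ : μ.cells => b).span_eq, Submodule.map_span,
    ← Set.range_comp]
  refine congrArg (fun f => Submodule.span R (Set.range f)) (funext fun t => ?_)
  rw [Function.comp_apply, Basis.piTensorProduct_apply, hL]
  rfl

/-- The Schur endofunctor `∇^λ` applied to a representation. -/
def schurRep (μ : YoungDiagram) : Representation R G (polytab R ρ μ).toSubmodule :=
  (polytab R ρ μ).toRepresentation

/-- The Weyl endofunctor `Δ^λ(V) = (∇^λ(V^*))^*` applied to a representation. -/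
def weylRep (μ : YoungDiagram) :
    Representation R G (Dual R (polytab R ρ.dual μ).toSubmodule) :=
  (schurRep R ρ.dual μ).dual

end Powers

section Labelled

/-! In this section `b` is a family of vectors, in the applications a basis of `V`; a tableau `t`
with entries in the index set of `b` stands for the tableau with entries in the basis. -/

variable {R : Type*} [CommRing R] {V : Type*} [AddCommGroup V] [Module R V]
  {ι : Type*} [DecidableEq ι] {μ : YoungDiagram}

/-- The row symmetrisation of a tableau, the sum of all its distinct row rearrangements. -/
def rowSym (b : ι → V) (t : Tableau μ ι) : SymLower R V μ :=
  ⟨∑ u ∈ rowOrbit t, PiTensorProduct.tprod R (b ∘ u), fun σ hσ => by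
    rw [map_sum]
    have key : ∀ τ ∈ rowPerms μ, ∀ u ∈ rowOrbit t, u.permute τ ∈ rowOrbit t := by
      intro τ hτ u hu
      obtain ⟨π, hπ, rfl⟩ := mem_rowOrbit.1 hu
      exact mem_rowOrbit.2 ⟨τ * π, mul_mem hτ hπ, by funext c; simp [Tableau.permute, mul_inv_rev]⟩
    refine Finset.sum_bij' (fun u _ => u.permute σ) (fun u _ => u.permute σ⁻¹)
      (key σ hσ) (key σ⁻¹ (inv_mem hσ)) ?_ ?_ ?_
    · intro u _; funext c; simp [Tableau.permute]
    · intro u _; funext c; simp [Tableau.permute]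
    · intro u _
      rw [PiTensorProduct.reindex_tprod]
      rfl⟩

/-- The copolytabloid of a tableau, the image of its row symmetrisation under the projection
`V^{⊗ |λ|} → Λ^{λ'} V`: the sum of the column tabloids of all its distinct row rearrangements. -/
def copolytabloid (R : Type*) [CommRing R] [Module R V] (b : ι → V) (t : Tableau μ ι) :
    ExtUpper R V μ :=
  ∑ u ∈ rowOrbit t, colTabloid R (b ∘ u)

/-- The space of copolytabloids. -/
def copolytab (b : Basis ι R V) (μ : YoungDiagram) : Submodule R (ExtUpper R V μ) :=
  Submodule.span R (Set.range fun t : Tableau μ ι => copolytabloid R b t)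

/-- The element of `Sym_λ V` given by the formula for the dual Garnir relation labelled by
`(t, A, B)`, where `C = A ∪ B` and where `T` is the chosen set of representatives. -/
def dualGarnirRel (b : ι → V) (C : Finset μ.cells) (T : Finset (Tableau μ ι)) :
    SymLower R V μ :=
  ∑ u ∈ T, (blockPerms C).relIndex (rowStab u) • rowSym b u

/-- The space of dual Garnir relations, spanned by the dual Garnir relations labelled by all
`(t, A, B)` with `A` and `B` sets of boxes in rows `i < i'` such that `|A| + |B| > λ_i`. -/
def dualGarnir (b : Basis ι R V) (μ : YoungDiagram) : Submodule R (SymLower R V μ) :=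
  Submodule.span R
    {x | ∃ (t : Tableau μ ι) (i i' : ℕ) (A B : Finset μ.cells) (T : Finset (Tableau μ ι)),
      i < i' ∧ (∀ c ∈ A, c.1.1 = i) ∧ (∀ c ∈ B, c.1.1 = i') ∧
      μ.rowLen i < A.card + B.card ∧
      IsRowTransversal (blockOrbit t (A ∪ B)) T ∧ x = dualGarnirRel b (A ∪ B) T}

end Labelled

end WeylModel

end

/-!
Why the theorem is true. A row-symmetric tensor `w` can be paired with a tableau `f` of functionals on
`V` by evaluating `f`, antisymmetrised over the column-preserving permutations, at `w`. Moving the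
antisymmetrisation to one side or the other, this pairing is the value at the polytabloid of `f` of a
functional on `Sym^λ V^*` given by `w` (`rowFunctional`), and also the value of a functional on
`Λ^{λ'} V` given by `f` (`columnFunctional`) at the image of `w` under the projection `symProj`; see
`rowFunctional_polytabloid`. Hence the Weyl endofunctor, the space of copolytabloids and the quotient
of `Sym_λ V` by the dual Garnir relations all map to the functions on tableaux of functionals. It is
shown that the three maps are injective with the same image. They are compatible with the
group, acting contragrediently on `f`, so they yield the isomorphisms.

Two combinatorial facts carry the proof. First, dual Garnir relations vanish in `Λ^{λ'} V`
(`sum_relIndex_smul_copolytabloid`): the index in the coefficient of a tableau counts the row translates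
of the block of boxes that is permuted (`relIndex_eq_ncard`). Collecting the terms with a fixed
translate gives a sum over a set of tableaux that is stable under all permutations of the translate,
and the translate has two boxes in one column. Second, modulo the dual Garnir relations every row
symmetrisation is a combination of semistandard ones (`rowSym_mem_span_semistandard`): choosing the
boxes of a relation to be unions of level sets of the tableau makes the leading coefficient one, and all
other terms have larger `weight`.

The matrix of pairings of semistandard tableaux is unitriangular for the weight
(`det_pairingMatrix`), hence invertible over every commutative ring. So a row-symmetric tensor that
pairs to zero with everything is a combination of dual Garnir relations
(`mem_dualGarnir_of_columnFunctional_eq_zero`). Linear algebra with this matrix then gives the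
statement on the dual side without a separate straightening of polytabloids: the semistandard
polytabloids span the Schur endofunctor of `V^*` (`polytabloid_mem_span_semistandard`), so each
functional on it is the pairing with a row-symmetric tensor (`exists_symLower_of_functional`).
-/

namespace WeylModel

/-! ### Row equivalence and contents of rows -/

section RowEquivalence

variable {μ : YoungDiagram} {X : Type*}

lemma Tableau.permute_permute (t : Tableau μ X) (σ τ : Equiv.Perm μ.cells) :
    (t.permute σ).permute τ = t.permute (τ * σ) := by
  funext c; simp [Tableau.permute, mul_inv_rev]

lemma Tableau.permute_one (t : Tableau μ X) : t.permute 1 = t := rfl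

lemma RowEquiv.refl (t : Tableau μ X) : RowEquiv t t := ⟨1, one_mem _, rfl⟩

lemma RowEquiv.symm {t u : Tableau μ X} (h : RowEquiv t u) : RowEquiv u t := by
  obtain ⟨σ, hσ, rfl⟩ := h
  exact ⟨σ⁻¹, inv_mem hσ, by rw [Tableau.permute_permute, inv_mul_cancel, Tableau.permute_one]⟩

lemma RowEquiv.trans {t u v : Tableau μ X} (h : RowEquiv t u) (h' : RowEquiv u v) :
    RowEquiv t v := by
  obtain ⟨σ, hσ, rfl⟩ := h
  obtain ⟨τ, hτ, rfl⟩ := h'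
  exact ⟨τ * σ, mul_mem hτ hσ, by rw [Tableau.permute_permute]⟩

variable (μ X) in
/-- Row equivalence as a setoid. -/
def rowSetoid : Setoid (Tableau μ X) := ⟨RowEquiv, RowEquiv.refl, RowEquiv.symm, RowEquiv.trans⟩

lemma rowOrbit_eq [DecidableEq X] {t u : Tableau μ X} (h : RowEquiv t u) :
    rowOrbit t = rowOrbit u := by
  ext v
  rw [mem_rowOrbit, mem_rowOrbit]
  exact ⟨h.symm.trans, h.trans⟩

/-- Every set of tableaux has a set of representatives for row equivalence, and one of the
representatives can be prescribed. -/
lemma exists_isRowTransversal_mem [Finite X] (S : Set (Tableau μ X)) {u : Tableau μ X}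
    (hu : u ∈ S) : ∃ T, IsRowTransversal S T ∧ u ∈ T := by
  classical
  let _ := Fintype.ofFinite X
  -- a representative function on classes, with value `u` on the class of `u`
  have hf : ∀ q : Quotient (rowSetoid μ X), ∃ w : Tableau μ X,
      (q = Quotient.mk _ u → w = u) ∧ ((∃ v ∈ S, Quotient.mk _ v = q) → w ∈ S ∧
        Quotient.mk _ w = q) := by
    intro q
    by_cases h : q = Quotient.mk _ u
    · exact ⟨u, fun _ => rfl, fun _ => ⟨hu, h.symm⟩⟩
    · by_cases h' : ∃ v ∈ S, Quotient.mk _ v = q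
      · obtain ⟨v, hv⟩ := h'
        exact ⟨v, fun h'' => absurd h'' h, fun _ => hv⟩
      · exact ⟨u, fun _ => rfl, fun h'' => absurd h'' h'⟩
  choose f hf1 hf2 using hf
  refine ⟨(Finset.univ.filter (· ∈ S)).image fun v => f (Quotient.mk _ v), ⟨?_, ?_⟩, ?_⟩
  · intro w hw
    simp only [Finset.mem_image, Finset.mem_filter, Finset.mem_univ, true_and] at hw
    obtain ⟨v, hv, rfl⟩ := hw
    exact (hf2 _ ⟨v, hv, rfl⟩).1
  · intro v hv
    refine ⟨f (Quotient.mk _ v), ⟨Finset.mem_image_of_mem _ (by simpa using hv), ?_⟩, ?_⟩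
    · exact Quotient.exact (hf2 _ ⟨v, hv, rfl⟩).2.symm
    · rintro w ⟨hw, hvw⟩
      simp only [Finset.mem_image, Finset.mem_filter, Finset.mem_univ, true_and] at hw
      obtain ⟨v', hv', rfl⟩ := hw
      have h1 := (hf2 _ ⟨v', hv', rfl⟩).2
      have h2 : (Quotient.mk (rowSetoid μ X) v) = Quotient.mk _ (f (Quotient.mk _ v')) :=
        Quotient.sound hvw
      rw [h2, h1]
  · exact Finset.mem_image.2 ⟨u, by simpa using hu, hf1 _ rfl⟩

lemma exists_isRowTransversal [Finite X] (S : Set (Tableau μ X)) :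
    ∃ T, IsRowTransversal S T := by
  obtain rfl | ⟨u, hu⟩ := S.eq_empty_or_nonempty
  · exact ⟨∅, by simp [IsRowTransversal]⟩
  · exact (exists_isRowTransversal_mem S hu).imp fun _ h => h.1

/-- Two functions on a finite type whose fibres have the same sizes differ by a permutation. -/
lemma exists_perm_comp_eq {Y Z : Type*} [Fintype Y] [DecidableEq Z] (f g : Y → Z)
    (h : ∀ z, (Finset.univ.filter fun y => f y = z).card =
      (Finset.univ.filter fun y => g y = z).card) :
    ∃ κ : Equiv.Perm Y, ∀ y, g (κ y) = f y := by
  have e : ∀ z, Nonempty ({y // f y = z} ≃ {y // g y = z}) := fun z =>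
    Fintype.card_eq.1 (by rw [Fintype.card_subtype, Fintype.card_subtype, h])
  exact ⟨Equiv.ofFiberEquiv fun z => (e z).some, Equiv.ofFiberEquiv_map _⟩

/-- Row equivalence means that corresponding rows have the same content. -/
lemma rowEquiv_iff_card [DecidableEq X] {t u : Tableau μ X} :
    RowEquiv t u ↔ ∀ k x, (Finset.univ.filter fun c : μ.cells => c.1.1 = k ∧ t c = x).card =
      (Finset.univ.filter fun c : μ.cells => c.1.1 = k ∧ u c = x).card := by
  constructor
  · rintro ⟨σ, hσ, rfl⟩ k x
    refine Finset.card_equiv σ fun c => ?_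
    simp only [Finset.mem_filter, Finset.mem_univ, true_and]
    simp [Tableau.permute, hσ c]
  · intro h
    obtain ⟨κ, hκ⟩ := exists_perm_comp_eq (fun c : μ.cells => (c.1.1, u c))
      (fun c : μ.cells => (c.1.1, t c)) (fun z => by
        simpa only [Prod.ext_iff] using (h z.1 z.2).symm)
    simp only [Prod.ext_iff] at hκ
    refine ⟨κ⁻¹, inv_mem (fun c => (hκ c).1), funext fun c => ?_⟩
    simpa [Tableau.permute] using (hκ c).2.symm

/-- Row equivalent tableaux that agree outside `C` differ by a row-preserving permutation that
preserves `C`. -/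
lemma RowEquiv.exists_mem_blockPerms {C : Finset μ.cells} {u v : Tableau μ X}
    (h : RowEquiv u v) (hC : ∀ c ∉ C, u c = v c) :
    ∃ κ ∈ rowPerms μ, κ ∈ blockPerms C ∧ v = u.permute κ := by
  classical
  have hcard : ∀ z : ℕ × Prop × X,
      (Finset.univ.filter fun c : μ.cells => (c.1.1, (c ∈ C), v c) = z).card =
        (Finset.univ.filter fun c : μ.cells => (c.1.1, (c ∈ C), u c) = z).card := by
    rintro ⟨k, p, x⟩
    have h0 := rowEquiv_iff_card.1 h k x
    have hout : (Finset.univ.filter fun c : μ.cells => (c.1.1 = k ∧ u c = x) ∧ c ∉ C) =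
        Finset.univ.filter fun c : μ.cells => (c.1.1 = k ∧ v c = x) ∧ c ∉ C := by
      ext c
      simp only [Finset.mem_filter, Finset.mem_univ, true_and]
      constructor <;> rintro ⟨⟨h1, h2⟩, h3⟩ <;> refine ⟨⟨h1, ?_⟩, h3⟩
      · rw [← hC c h3, h2]
      · rw [hC c h3, h2]
    have e1 := Finset.card_filter_add_card_filter_not
      (s := Finset.univ.filter fun c : μ.cells => c.1.1 = k ∧ u c = x) (fun c => c ∈ C)
    have e2 := Finset.card_filter_add_card_filter_not
      (s := Finset.univ.filter fun c : μ.cells => c.1.1 = k ∧ v c = x) (fun c => c ∈ C)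
    simp only [Finset.filter_filter] at e1 e2
    rw [hout] at e1
    have hkey : (Finset.univ.filter fun c : μ.cells => (c.1.1 = k ∧ v c = x) ∧ c ∈ C).card =
        (Finset.univ.filter fun c : μ.cells => (c.1.1 = k ∧ u c = x) ∧ c ∈ C).card := by omega
    have hc1 : ∀ (c : μ.cells) (q : Prop), (c ∈ C ∧ q) ↔ (q ∧ c ∈ C) := fun _ _ => and_comm
    have hc2 : ∀ (c : μ.cells) (q : Prop), (c ∉ C ∧ q) ↔ (q ∧ c ∉ C) := fun _ _ => and_comm
    by_cases hp : p
    · simpa only [Prod.ext_iff, hp, eq_iff_iff, iff_true, hc1, and_assoc] using hkey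
    · simpa only [Prod.ext_iff, hp, eq_iff_iff, iff_false, hc2, and_assoc]
        using (congrArg Finset.card hout).symm
  obtain ⟨κ, hκ⟩ := exists_perm_comp_eq _ _ hcard
  simp only [Prod.ext_iff, eq_iff_iff] at hκ
  refine ⟨κ⁻¹, inv_mem (fun c => (hκ c).1), inv_mem (fun c => (hκ c).2.1), funext fun c => ?_⟩
  simpa [Tableau.permute] using (hκ c).2.2.symm

end RowEquivalence

/-! ### Semistandard tableaux and the weight of a tableau -/

section Semistandard

variable {μ : YoungDiagram} {X : Type*}

/-- A tableau is semistandard, with respect to the order on entries given by the ranks `r`, if its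
rows weakly increase and its columns strictly increase. -/
def IsSemistandard (r : X → ℕ) (t : Tableau μ X) : Prop :=
  (∀ c d : μ.cells, c.1.1 = d.1.1 → c.1.2 ≤ d.1.2 → r (t c) ≤ r (t d)) ∧
    ∀ c d : μ.cells, c.1.2 = d.1.2 → c.1.1 < d.1.1 → r (t c) < r (t d)

/-- The weight of a tableau: the sum of the ranks of its entries, each multiplied by the index of
its row. -/
def weight (r : X → ℕ) (t : Tableau μ X) : ℤ := ∑ c, (c.1.1 : ℤ) * r (t c)

lemma weight_permute (r : X → ℕ) (t : Tableau μ X) (σ : Equiv.Perm μ.cells) :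
    weight r (t.permute σ) = ∑ c, ((σ c).1.1 : ℤ) * r (t c) := by
  rw [weight, ← Equiv.sum_comp σ]
  simp [Tableau.permute]

lemma RowEquiv.weight_eq {r : X → ℕ} {t u : Tableau μ X} (h : RowEquiv t u) :
    weight r t = weight r u := by
  obtain ⟨σ, hσ, rfl⟩ := h
  rw [weight_permute, weight]
  exact Finset.sum_congr rfl fun c _ => by rw [hσ c]

lemma sum_row_comp (σ : Equiv.Perm μ.cells) :
    ∑ c, ((σ c).1.1 : ℤ) = ∑ c : μ.cells, (c.1.1 : ℤ) :=
  Equiv.sum_comp σ fun c : μ.cells => (c.1.1 : ℤ)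

/-- Some row rearrangement of a tableau has weakly increasing rows. -/
lemma exists_rowEquiv_rowSorted (r : X → ℕ) (t : Tableau μ X) :
    ∃ u, RowEquiv t u ∧
      ∀ c d : μ.cells, c.1.1 = d.1.1 → c.1.2 ≤ d.1.2 → r (u c) ≤ r (u d) := by
  classical
  -- maximise the sum of the ranks weighted by the column index
  obtain ⟨u, hu, hmax⟩ := (rowOrbit t).exists_max_image
    (fun u => ∑ c, (c.1.2 : ℤ) * r (u c)) ⟨t, mem_rowOrbit.2 (RowEquiv.refl t)⟩
  rw [mem_rowOrbit] at hu
  refine ⟨u, hu, fun c d hcd hle => ?_⟩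
  by_contra! hlt
  obtain hlt' | heq := hle.lt_or_eq
  swap
  · rw [show c = d from Subtype.ext (Prod.ext hcd heq)] at hlt
    exact hlt.false
  have hswap : Equiv.swap c d ∈ rowPerms μ := by
    intro e
    rcases eq_or_ne e c with rfl | h1
    · rw [Equiv.swap_apply_left, hcd]
    rcases eq_or_ne e d with rfl | h2
    · rw [Equiv.swap_apply_right, hcd]
    rw [Equiv.swap_apply_of_ne_of_ne h1 h2]
  have h := hmax _ (mem_rowOrbit.2 (hu.trans ⟨_, hswap, rfl⟩))
  have hne : c ≠ d := by rintro rfl; exact hlt'.false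
  have hsplit : ∀ w : Tableau μ X, ∑ e, (e.1.2 : ℤ) * r (w e) =
      c.1.2 * r (w c) + (d.1.2 * r (w d) +
        ∑ e ∈ (Finset.univ.erase c).erase d, (e.1.2 : ℤ) * r (w e)) := fun w => by
    rw [Finset.add_sum_erase _ (fun e : μ.cells => (e.1.2 : ℤ) * r (w e))
      (Finset.mem_erase.2 ⟨hne.symm, Finset.mem_univ d⟩),
      Finset.add_sum_erase _ (fun e : μ.cells => (e.1.2 : ℤ) * r (w e)) (Finset.mem_univ c)]
  rw [hsplit, hsplit u] at h
  have hrest : ∑ e ∈ (Finset.univ.erase c).erase d, (e.1.2 : ℤ) *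
      r (u.permute (Equiv.swap c d) e) =
      ∑ e ∈ (Finset.univ.erase c).erase d, (e.1.2 : ℤ) * r (u e) := by
    refine Finset.sum_congr rfl fun e he => ?_
    simp only [Finset.mem_erase] at he
    rw [Tableau.permute, Equiv.swap_inv, Equiv.swap_apply_of_ne_of_ne he.2.1 he.1]
  rw [hrest] at h
  simp only [Tableau.permute, Equiv.swap_inv, Equiv.swap_apply_left, Equiv.swap_apply_right] at h
  have h1 : (r (u d) : ℤ) < r (u c) := by exact_mod_cast hlt
  have h2 : (c.1.2 : ℤ) < d.1.2 := by exact_mod_cast hlt'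
  nlinarith

/-- Moving the entries of `C` around increases the weight, unless it only rearranges rows, if the
entries of `C` in the lower row `i'` are at most `a` and those in the upper row `i` at least `a`. -/
lemma rowEquiv_or_weight_lt {r : X → ℕ} (hr : Function.Injective r) {t : Tableau μ X}
    {A B : Finset μ.cells} {i i' a : ℕ} (hi : i < i')
    (hA : ∀ c ∈ A, c.1.1 = i) (hB : ∀ c ∈ B, c.1.1 = i')
    (hAa : ∀ c ∈ A, a ≤ r (t c)) (hBa : ∀ c ∈ B, r (t c) ≤ a)
    {τ : Equiv.Perm μ.cells} (hτ : ∀ c ∉ A ∪ B, τ c = c) :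
    RowEquiv t (t.permute τ) ∨ weight r t < weight r (t.permute τ) := by
  classical
  have hmem : ∀ c, c ∈ A ∪ B → τ c ∈ A ∪ B := by
    intro c hc
    by_contra h
    exact h (by rw [τ.injective (hτ _ h)]; exact hc)
  have hrow : ∀ c ∈ A ∪ B, i ≤ (τ c).1.1 ∧ (τ c).1.1 ≤ i' := by
    intro c hc
    rcases Finset.mem_union.1 (hmem c hc) with h | h
    · rw [hA _ h]; omega
    · rw [hB _ h]; omega
  -- the weight changes by a sum of nonnegative terms
  have hdiff : weight r (t.permute τ) - weight r t =
      ∑ c, (((τ c).1.1 : ℤ) - c.1.1) * (r (t c) - a) := by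
    rw [weight_permute, weight]
    have h := sum_row_comp τ
    simp only [sub_mul, mul_sub, Finset.sum_sub_distrib, ← Finset.sum_mul, h]
    ring
  have hnn : ∀ c ∈ (Finset.univ : Finset μ.cells),
      0 ≤ (((τ c).1.1 : ℤ) - c.1.1) * (r (t c) - a) := by
    intro c _
    by_cases hc : c ∈ A ∪ B
    · have h := hrow c hc
      rcases Finset.mem_union.1 hc with h' | h'
      · have h1 := hAa c h'
        have h2 := hA c h'
        exact mul_nonneg (by omega) (by omega)
      · have h1 := hBa c h'
        have h2 := hB c h'
        exact mul_nonneg_of_nonpos_of_nonpos (by omega) (by omega)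
    · rw [hτ c hc]; simp
  rcases (Finset.sum_nonneg hnn).lt_or_eq with h | h
  · right; omega
  left
  have h0 := (Finset.sum_eq_zero_iff_of_nonneg hnn).1 h.symm
  have h1 : ∀ c, r (t c) ≠ a → (τ c).1.1 = c.1.1 := by
    intro c hc
    rcases mul_eq_zero.1 (h0 c (Finset.mem_univ c)) with h | h <;> omega
  rw [rowEquiv_iff_card]
  intro k x
  have hτk : ∀ p : X → Prop, ∀ [DecidablePred p],
      (Finset.univ.filter fun c : μ.cells => c.1.1 = k ∧ p (t.permute τ c)).card =
        (Finset.univ.filter fun c : μ.cells => (τ c).1.1 = k ∧ p (t c)).card := by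
    intro p _
    refine (Finset.card_equiv τ fun c => ?_).symm
    simp only [Finset.mem_filter, Finset.mem_univ, true_and]
    simp [Tableau.permute]
  rw [hτk (· = x)]
  by_cases hx : r x = a
  · -- count the complement within each row
    have e1 := Finset.card_filter_add_card_filter_not
      (s := Finset.univ.filter fun c : μ.cells => c.1.1 = k) (fun c => t c = x)
    have e2 := Finset.card_filter_add_card_filter_not
      (s := Finset.univ.filter fun c : μ.cells => (τ c).1.1 = k) (fun c => t c = x)
    have e3 : (Finset.univ.filter fun c : μ.cells => (τ c).1.1 = k).card =
        (Finset.univ.filter fun c : μ.cells => c.1.1 = k).card :=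
      Finset.card_equiv τ fun c => by simp
    simp only [Finset.filter_filter] at e1 e2
    have e4 : (Finset.univ.filter fun c : μ.cells => (τ c).1.1 = k ∧ ¬t c = x) =
        Finset.univ.filter fun c : μ.cells => c.1.1 = k ∧ ¬t c = x := by
      ext c
      simp only [Finset.mem_filter, Finset.mem_univ, true_and]
      refine and_congr_left fun h => ?_
      rw [h1 c fun h' => h (hr (h'.trans hx.symm))]
    rw [e4] at e2
    omega
  · congr 1
    ext c
    simp only [Finset.mem_filter, Finset.mem_univ, true_and]
    refine and_congr_left fun h => ?_
    rw [h1 c (by rw [h]; exact hx)]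

/-- A column-preserving permutation that is increasing on each column is trivial. -/
lemma eq_one_of_mem_colPerms {σ : Equiv.Perm μ.cells} (hσ : σ ∈ colPerms μ)
    (h : ∀ c d : μ.cells, c.1.2 = d.1.2 → c.1.1 < d.1.1 → (σ c).1.1 ≤ (σ d).1.1) : σ = 1 := by
  have hle : ∀ n, ∀ c : μ.cells, c.1.1 = n → n ≤ (σ c).1.1 := by
    intro n
    induction n with
    | zero => simp
    | succ n ih =>
      intro c hc
      have hd : ((n, c.1.2) : ℕ × ℕ) ∈ μ.cells :=
        μ.up_left_mem (show n ≤ c.1.1 by omega) le_rfl c.2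
      have h1 := ih ⟨_, hd⟩ rfl
      have h2 := h ⟨_, hd⟩ c rfl (by simp [hc])
      refine (lt_of_le_of_ne (h1.trans h2) fun h3 => ?_)
      have h4 : σ ⟨_, hd⟩ = σ c := by
        refine Subtype.ext (Prod.ext (by omega) ?_)
        rw [hσ, hσ]
      have h5 := congrArg (fun e : μ.cells => e.1.1) (σ.injective h4)
      simp [hc] at h5
  have hsum : ∑ c : μ.cells, c.1.1 = ∑ c, (σ c).1.1 :=
    (Equiv.sum_comp σ fun c : μ.cells => c.1.1).symm
  have heq := (Finset.sum_eq_sum_iff_of_le fun c _ => hle _ c rfl).1 hsum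
  ext1 c
  exact Subtype.ext (Prod.ext (heq c (Finset.mem_univ c)).symm (hσ c))

/-- Nontrivial column permutations strictly decrease the weight of a semistandard tableau. -/
lemma IsSemistandard.weight_permute_lt {r : X → ℕ} {s : Tableau μ X} (hs : IsSemistandard r s)
    {σ : Equiv.Perm μ.cells} (hσ : σ ∈ colPerms μ) (h1 : σ ≠ 1) :
    weight r (s.permute σ) < weight r s := by
  -- adding multiples of the column index makes rows and entries vary together on all boxes, and
  -- changes the two sums by the same amount
  obtain ⟨N, hN⟩ : ∃ N : ℕ, ∀ c : μ.cells, c.1.1 < N ∧ r (s c) < N := by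
    refine ⟨(∑ c : μ.cells, (c.1.1 + r (s c))) + 1, fun c => ?_⟩
    have := Finset.single_le_sum (f := fun c : μ.cells => c.1.1 + r (s c))
      (fun _ _ => Nat.zero_le _) (Finset.mem_univ c)
    omega
  let f : μ.cells → ℤ := fun c => c.1.1 + N * c.1.2
  let g : μ.cells → ℤ := fun c => r (s c) + N * c.1.2
  have hcol : ∀ (p : μ.cells → ℕ) (_ : ∀ c, p c < N) (c d : μ.cells), c.1.2 < d.1.2 →
      (p c : ℤ) + N * c.1.2 < p d + N * d.1.2 := by
    intro p hp c d hcd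
    have h1 := hp c
    have h2 : N * (c.1.2 + 1) ≤ N * d.1.2 := Nat.mul_le_mul_left _ hcd
    have h3 : p c + N * c.1.2 < p d + N * d.1.2 := by
      rw [mul_add] at h2; omega
    exact_mod_cast h3
  have hfg : Monovary f g := by
    intro c d hcd
    rcases lt_trichotomy c.1.2 d.1.2 with h | h | h
    · exact (hcol (fun c => c.1.1) (fun c => (hN c).1) c d h).le
    · simp only [f, g, h] at hcd ⊢
      by_contra! h'
      have := hs.2 d c h.symm (by omega)
      omega
    · exact absurd hcd (hcol (fun c => r (s c)) (fun c => (hN c).2) d c h).not_gt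
  have hlt : ∑ c, f (σ c) * g c < ∑ c, f c * g c := by
    refine hfg.sum_comp_perm_mul_lt_sum_mul_iff.2 fun hm => h1 (eq_one_of_mem_colPerms hσ ?_)
    intro c d hcd hlt
    have h2 := hs.2 c d hcd hlt
    have h3 : f (σ c) ≤ f (σ d) := hm (by simp only [g, hcd]; omega)
    simp only [f, hσ c, hσ d, hcd] at h3
    omega
  have hσ2 : ∀ c, (((σ c).1.2 : ℕ) : ℤ) = c.1.2 := fun c => by rw [hσ c]
  have hx : ∑ c : μ.cells, ((σ c).1.1 : ℤ) * (N * c.1.2) =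
      ∑ c : μ.cells, (c.1.1 : ℤ) * (N * c.1.2) := by
    rw [← Equiv.sum_comp σ fun c : μ.cells => (c.1.1 : ℤ) * (N * c.1.2)]
    exact Finset.sum_congr rfl fun c _ => by rw [hσ2]
  rw [weight_permute, weight]
  simp only [f, g, hσ2, add_mul, mul_add, Finset.sum_add_distrib] at hlt hx
  linarith

end Semistandard

/-! ### Straightening by dual Garnir relations -/

section Straightening

variable {μ : YoungDiagram} {X : Type*}

/-- A tableau with weakly increasing rows that is not semistandard has boxes `c` above `d` in one
column with entries `t c ≥ t d`.  The entries at least `t c` in the row of `c` and the entries at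
most `t c` in the row of `d` then label a dual Garnir relation. -/
lemma exists_garnir_boxes (r : X → ℕ) {t : Tableau μ X}
    (hrow : ∀ c d : μ.cells, c.1.1 = d.1.1 → c.1.2 ≤ d.1.2 → r (t c) ≤ r (t d))
    (ht : ¬IsSemistandard r t) :
    ∃ (i i' a : ℕ) (A B : Finset μ.cells), i < i' ∧ μ.rowLen i < A.card + B.card ∧
      (∀ c, c ∈ A ↔ c.1.1 = i ∧ a ≤ r (t c)) ∧ ∀ c, c ∈ B ↔ c.1.1 = i' ∧ r (t c) ≤ a := by
  classical
  obtain ⟨c, d, hcol, hlt, hle⟩ : ∃ c d : μ.cells, c.1.2 = d.1.2 ∧ c.1.1 < d.1.1 ∧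
      r (t d) ≤ r (t c) := by
    by_contra! h
    exact ht ⟨hrow, h⟩
  refine ⟨c.1.1, d.1.1, r (t c), Finset.univ.filter fun e => e.1.1 = c.1.1 ∧ r (t c) ≤ r (t e),
    Finset.univ.filter fun e => e.1.1 = d.1.1 ∧ r (t e) ≤ r (t c), hlt, ?_, by simp, by simp⟩
  have hA : Finset.Ico c.1.2 (μ.rowLen c.1.1) ⊆
      (Finset.univ.filter fun e : μ.cells => e.1.1 = c.1.1 ∧ r (t c) ≤ r (t e)).image
        (fun e => e.1.2) := by
    intro j hj
    rw [Finset.mem_Ico] at hj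
    refine Finset.mem_image.2 ⟨⟨(c.1.1, j), YoungDiagram.mem_iff_lt_rowLen.2 hj.2⟩, ?_, rfl⟩
    simp only [Finset.mem_filter, Finset.mem_univ, true_and]
    exact hrow _ _ rfl hj.1
  have hB : Finset.range (d.1.2 + 1) ⊆
      (Finset.univ.filter fun e : μ.cells => e.1.1 = d.1.1 ∧ r (t e) ≤ r (t c)).image
        (fun e => e.1.2) := by
    intro j hj
    rw [Finset.mem_range, Nat.lt_succ_iff] at hj
    refine Finset.mem_image.2 ⟨⟨(d.1.1, j), μ.up_left_mem le_rfl hj d.2⟩, ?_, rfl⟩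
    simp only [Finset.mem_filter, Finset.mem_univ, true_and]
    exact (hrow ⟨(d.1.1, j), _⟩ d rfl hj).trans hle
  have h1 := (Finset.card_le_card hA).trans Finset.card_image_le
  have h2 := (Finset.card_le_card hB).trans Finset.card_image_le
  rw [Nat.card_Ico] at h1
  rw [Finset.card_range] at h2
  have h3 : c.1.2 < μ.rowLen c.1.1 := YoungDiagram.mem_iff_lt_rowLen.1 c.2
  omega

variable {R : Type*} [CommRing R] {V : Type*} [AddCommGroup V] [Module R V]
  {ι : Type*} [DecidableEq ι]

lemma rowSym_eq (b : ι → V) {t u : Tableau μ ι} (h : RowEquiv t u) :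
    (rowSym b t : SymLower R V μ) = rowSym b u :=
  Subtype.ext (by simp only [rowSym, rowOrbit_eq h])

/-- Summing over the row orbits of a set of representatives is summing over all tableaux that are
row equivalent to an element of the given set. -/
lemma IsRowTransversal.sum_rowOrbit [Fintype ι] {M : Type*} [AddCommMonoid M]
    {S : Set (Tableau μ ι)} {T : Finset (Tableau μ ι)} (hT : IsRowTransversal S T)
    [DecidablePred fun x : Tableau μ ι => ∃ v ∈ S, RowEquiv v x] (f : Tableau μ ι → M) :
    ∑ u ∈ T, ∑ x ∈ rowOrbit u, f x =
      ∑ x : Tableau μ ι with ∃ v ∈ S, RowEquiv v x, f x := by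
  rw [← Finset.sum_biUnion]
  · refine Finset.sum_congr ?_ fun _ _ => rfl
    ext x
    simp only [Finset.mem_biUnion, mem_rowOrbit, Finset.mem_filter, Finset.mem_univ, true_and]
    constructor
    · rintro ⟨u, hu, hux⟩
      exact ⟨u, hT.1 u hu, hux⟩
    · rintro ⟨v, hv, hvx⟩
      obtain ⟨u, ⟨hu, hvu⟩, -⟩ := hT.2 v hv
      exact ⟨u, hu, hvu.symm.trans hvx⟩
  · intro u hu v hv huv
    refine Finset.disjoint_left.2 fun x hxu hxv => huv ?_
    rw [mem_rowOrbit] at hxu hxv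
    obtain ⟨w, -, hw⟩ := hT.2 u (hT.1 u hu)
    exact (hw u ⟨hu, RowEquiv.refl u⟩).trans (hw v ⟨hv, hxu.trans hxv.symm⟩).symm

/-- The row symmetrisations of tableaux with entries in a basis span `Sym_λ V`. -/
lemma span_rowSym [Finite ι] (b : Basis ι R V) (μ : YoungDiagram) :
    Submodule.span R (Set.range fun t : Tableau μ ι => (rowSym b t : SymLower R V μ)) = ⊤ := by
  classical
  let _ := Fintype.ofFinite ι
  let E := Basis.piTensorProduct fun _ : μ.cells => b
  have hE : ∀ t : Tableau μ ι, E t = PiTensorProduct.tprod R (b ∘ t) := fun t =>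
    Basis.piTensorProduct_apply _ _
  refine eq_top_iff.2 fun w _ => ?_
  -- the coordinates of a row-symmetric tensor are constant on row equivalence classes
  have hinv : ∀ t u : Tableau μ ι, RowEquiv t u → E.coord u w = E.coord t w := by
    rintro t _ ⟨σ, hσ, rfl⟩
    have h : E.coord (t.permute σ) ∘ₗ
        (PiTensorProduct.reindex R (fun _ => V) σ).toLinearMap = E.coord t := by
      refine E.ext fun (u : Tableau μ ι) => ?_
      have h1 : PiTensorProduct.reindex R (fun _ => V) σ (E u) = E (u.permute σ) := by
        rw [hE, hE, PiTensorProduct.reindex_tprod]; rfl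
      have h2 : u.permute σ = t.permute σ ↔ u = t := by
        constructor
        · intro h
          have := congrArg (fun v => Tableau.permute v σ⁻¹) h
          simpa [Tableau.permute_permute, Tableau.permute_one] using this
        · rintro rfl; rfl
      rw [LinearMap.comp_apply, LinearEquiv.coe_coe, h1, Basis.coord_apply, Basis.coord_apply,
        Basis.repr_self, Basis.repr_self]
      simp only [Finsupp.single_apply, h2]
    rw [← LinearMap.congr_fun h w, LinearMap.comp_apply, LinearEquiv.coe_coe, w.2 σ hσ]
  obtain ⟨T, hT⟩ := exists_isRowTransversal (Set.univ : Set (Tableau μ ι))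
  have hw : w = ∑ u ∈ T, E.coord u w • (rowSym b u : SymLower R V μ) := by
    refine Subtype.ext ?_
    have h := hT.sum_rowOrbit fun t => E.coord t w • E t
    rw [Finset.filter_true_of_mem fun x _ => ⟨x, trivial, RowEquiv.refl x⟩] at h
    rw [Submodule.coe_sum, ← E.sum_repr w]
    refine h.symm.trans (Finset.sum_congr rfl fun u _ => ?_)
    rw [Submodule.coe_smul, rowSym, Finset.smul_sum, E.sum_repr]
    exact Finset.sum_congr rfl fun x hx => by rw [hinv u x (mem_rowOrbit.1 hx), hE]
  rw [hw]
  exact Submodule.sum_mem _ fun u _ => Submodule.smul_mem _ _ (Submodule.subset_span ⟨u, rfl⟩)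

/-- Straightening: modulo the dual Garnir relations, every row symmetrisation is a linear
combination of those of semistandard tableaux. -/
lemma rowSym_mem_span_semistandard [Finite ι] (b : Basis ι R V) {r : ι → ℕ}
    (hr : Function.Injective r) (t : Tableau μ ι) :
    (rowSym b t : SymLower R V μ) ∈
      Submodule.span R ((fun s => rowSym b s) '' {s : Tableau μ ι | IsSemistandard r s}) ⊔
        dualGarnir b μ := by
  classical
  let _ := Fintype.ofFinite ι
  let _ : IsTrans (Tableau μ ι) fun u v => weight r v < weight r u := ⟨fun _ _ _ h h' => h'.trans h⟩
  let _ : Std.Irrefl fun u v : Tableau μ ι => weight r v < weight r u := ⟨fun _ h => h.false⟩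
  induction t using (Finite.wellFounded_of_trans_of_irrefl
    fun u v : Tableau μ ι => weight r v < weight r u).induction with
  | _ t ih =>
  obtain ⟨u, htu, hu⟩ := exists_rowEquiv_rowSorted r t
  rw [rowSym_eq b htu]
  by_cases hss : IsSemistandard r u
  · exact Submodule.mem_sup_left (Submodule.subset_span ⟨u, hss, rfl⟩)
  obtain ⟨i, i', a, A, B, hi, hcard, hA, hB⟩ := exists_garnir_boxes r hu hss
  obtain ⟨T, hT, huT⟩ := exists_isRowTransversal_mem (blockOrbit u (A ∪ B))
    (u := u) ⟨1, fun _ _ => rfl, rfl⟩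
  have hrel : (dualGarnirRel b (A ∪ B) T : SymLower R V μ) ∈ dualGarnir b μ :=
    Submodule.subset_span ⟨u, i, i', A, B, T, hi, fun c hc => ((hA c).1 hc).1,
      fun c hc => ((hB c).1 hc).1, hcard, hT, rfl⟩
  -- `A ∪ B` is a union of level sets of `u` in two rows, so the coefficient of `u` is one
  have hone : (blockPerms (A ∪ B)).relIndex (rowStab u) = 1 := by
    rw [Subgroup.relIndex_eq_one]
    intro σ hσ c
    rw [Finset.mem_union, Finset.mem_union, hA, hB, hA, hB, hσ.1 c, hσ.2 c]
  rw [dualGarnirRel, ← Finset.add_sum_erase _ _ huT, hone, one_smul] at hrel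
  have hrest : ∑ v ∈ T.erase u, (blockPerms (A ∪ B)).relIndex (rowStab v) •
      (rowSym b v : SymLower R V μ) ∈
      Submodule.span R ((fun s => rowSym b s) '' {s : Tableau μ ι | IsSemistandard r s}) ⊔
        dualGarnir b μ := by
    refine Submodule.sum_mem _ fun v hv => nsmul_mem (ih v ?_) _
    obtain ⟨hvu, hvT⟩ := Finset.mem_erase.1 hv
    obtain ⟨τ, hτ, rfl⟩ := hT.1 v hvT
    rw [htu.weight_eq]
    refine (rowEquiv_or_weight_lt hr hi (fun c hc => ((hA c).1 hc).1)
      (fun c hc => ((hB c).1 hc).1) (fun c hc => ((hA c).1 hc).2)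
      (fun c hc => ((hB c).1 hc).2) hτ).resolve_left fun h => hvu ?_
    obtain ⟨w, -, hw⟩ := hT.2 u (hT.1 u huT)
    exact (hw _ ⟨hvT, h⟩).trans (hw u ⟨huT, RowEquiv.refl u⟩).symm
  have := sub_mem (Submodule.mem_sup_right (S := Submodule.span R
    ((fun s => rowSym b s) '' {s : Tableau μ ι | IsSemistandard r s})) hrel) hrest
  rwa [add_sub_cancel_right] at this

end Straightening

/-! ### Column tabloids and the vanishing of the dual Garnir relations -/

section Garnir

variable {μ : YoungDiagram}

variable (μ) in
/-- The boxes of a Young diagram, listed column by column. -/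
def colCells : (Σ j : Fin (μ.rowLen 0), Fin (μ.colLen j)) ≃ μ.cells where
  toFun x := ⟨(x.2, x.1), μ.mem_iff_lt_colLen.2 x.2.2⟩
  invFun c := ⟨⟨c.1.2, μ.mem_iff_lt_rowLen.1 (μ.up_left_mem (Nat.zero_le _) le_rfl c.2)⟩,
    ⟨c.1.1, μ.mem_iff_lt_colLen.1 c.2⟩⟩
  left_inv _ := rfl
  right_inv _ := rfl

variable (R : Type*) [CommRing R] {V : Type*} [AddCommGroup V] [Module R V]

variable (V μ) in
/-- Column tabloids are multilinear in the entries of the tableau. -/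
noncomputable def colTabloidMultilinear :
    MultilinearMap R (fun _ : μ.cells => V) (ExtUpper R V μ) :=
  MultilinearMap.domDomCongr (colCells μ)
    ((PiTensorProduct.tprod R).compMultilinearMap fun j : Fin (μ.rowLen 0) =>
      (exteriorPower.ιMulti R (μ.colLen j) (M := V)).toMultilinearMap)

lemma colTabloid_eq_zero {v : Tableau μ V} {c d : μ.cells} (hcol : c.1.2 = d.1.2) (hne : c ≠ d)
    (h : v c = v d) : colTabloid R v = 0 := by
  obtain ⟨⟨j, i⟩, rfl⟩ := (colCells μ).surjective c
  obtain ⟨⟨j', i'⟩, rfl⟩ := (colCells μ).surjective d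
  obtain rfl : j = j' := Fin.ext hcol
  refine MultilinearMap.map_coord_zero _ j ?_
  exact AlternatingMap.map_eq_zero_of_eq _ _ h fun h' => hne (by subst h'; rfl)

lemma colTabloid_permute_swap (v : Tableau μ V) {c d : μ.cells} (hcol : c.1.2 = d.1.2)
    (hne : c ≠ d) : colTabloid R (v.permute (Equiv.swap c d)) = -colTabloid R v := by
  obtain ⟨⟨j, i⟩, rfl⟩ := (colCells μ).surjective c
  obtain ⟨⟨j', i'⟩, rfl⟩ := (colCells μ).surjective d
  obtain rfl : j = j' := Fin.ext hcol
  let F : ∀ k : Fin (μ.rowLen 0), ⋀[R]^(μ.colLen k) V := fun k =>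
    exteriorPower.ιMulti R (μ.colLen k) fun l => v (colCells μ ⟨k, l⟩)
  have hF : colTabloid R v = PiTensorProduct.tprod R F := rfl
  have h : colTabloid R (v.permute (Equiv.swap (colCells μ ⟨j, i⟩) (colCells μ ⟨j, i'⟩))) =
      PiTensorProduct.tprod R (Function.update F j ((-1 : R) • F j)) := by
    rw [colTabloid]
    congr 1
    funext k
    by_cases hk : k = j
    · subst hk
      rw [Function.update_self]
      have hii : i ≠ i' := fun h' => hne (by subst h'; rfl)
      refine Eq.trans ?_ (neg_one_smul R (F k)).symm
      rw [← AlternatingMap.map_swap _ _ hii]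
      congr 1
      funext l
      simp only [Tableau.permute, Equiv.swap_inv, Function.comp_apply]
      congr 1
      change Equiv.swap (colCells μ ⟨k, i⟩) (colCells μ ⟨k, i'⟩) (colCells μ ⟨k, l⟩) = _
      rw [← (colCells μ).injective.map_swap]
      congr 1
      exact ((sigma_mk_injective (β := fun j : Fin (μ.rowLen 0) => Fin (μ.colLen j))
        (i := k)).map_swap i i' l).symm
    · rw [Function.update_of_ne hk]
      congr 1
      funext l
      simp only [Tableau.permute, Equiv.swap_inv]
      congr 1
      change Equiv.swap (colCells μ ⟨j, i⟩) (colCells μ ⟨j, i'⟩) (colCells μ ⟨k, l⟩) =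
        colCells μ ⟨k, l⟩
      refine Equiv.swap_apply_of_ne_of_ne ?_ ?_ <;>
      · intro h'
        exact hk (congrArg Sigma.fst ((colCells μ).injective h'))
  rw [h, MultilinearMap.map_update_smul, Function.update_eq_self, hF]
  exact neg_one_smul R (PiTensorProduct.tprod R F)

open scoped Pointwise in
/-- The coefficient of a dual Garnir relation counts positions: for `x` row equivalent to `u`, it is
the number of sets of boxes to which a row-preserving permutation can carry `C` while carrying some
element of the block orbit to `x`. -/
lemma relIndex_eq_ncard {X : Type*} {t u x : Tableau μ X} {C : Finset μ.cells}
    (hu : u ∈ blockOrbit t C) (hx : RowEquiv u x) :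
    (blockPerms C).relIndex (rowStab u) =
      {D : Finset μ.cells | ∃ π ∈ rowPerms μ, ∃ v ∈ blockOrbit t C,
        x = v.permute π ∧ D = π • C}.ncard := by
  obtain ⟨ρ, hρ, rfl⟩ := hx
  have hstab : (blockPerms C).subgroupOf (rowStab u) = MulAction.stabilizer (rowStab u) C := by
    ext σ
    rw [Subgroup.mem_subgroupOf, MulAction.mem_stabilizer_iff]
    constructor
    · intro h
      ext c
      have := (inv_mem h : (σ : Equiv.Perm μ.cells)⁻¹ ∈ blockPerms C) c
      rw [← this, ← Finset.inv_smul_mem_iff]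
      rfl
    · intro h c
      conv_lhs => rw [← h]
      exact Finset.smul_mem_smul_finset_iff σ
  rw [Subgroup.relIndex, hstab, MulAction.index_stabilizer,
    ← Set.ncard_image_of_injective _ (MulAction.injective (β := Finset μ.cells) ρ)]
  congr 1
  have hperm : ∀ {σ : Equiv.Perm μ.cells} (w : Tableau μ X), w.permute σ = w →
      ∀ c, w (σ c) = w c := by
    intro σ w h c
    conv_lhs => rw [← h]
    simp [Tableau.permute]
  ext D
  constructor
  · rintro ⟨_, ⟨⟨σ, hσ⟩, rfl⟩, rfl⟩
    refine ⟨ρ * σ, mul_mem hρ hσ.1, u, hu, ?_, ?_⟩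
    · rw [← Tableau.permute_permute]
      congr 1
      funext c
      have := hσ.2 (σ⁻¹ c)
      simpa [Tableau.permute] using this
    · rw [mul_smul]; rfl
  · rintro ⟨π, hπ, v, hv, h, rfl⟩
    have hout : ∀ c ∉ C, u c = v c := by
      obtain ⟨τ, hτ, rfl⟩ := hu
      obtain ⟨τ', hτ', rfl⟩ := hv
      intro c hc
      have h1 : τ⁻¹ c = c := by rw [Equiv.Perm.inv_eq_iff_eq]; exact (hτ c hc).symm
      have h2 : τ'⁻¹ c = c := by rw [Equiv.Perm.inv_eq_iff_eq]; exact (hτ' c hc).symm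
      simp only [Tableau.permute, h1, h2]
    have huv : RowEquiv u v := by
      refine ⟨π⁻¹ * ρ, mul_mem (inv_mem hπ) hρ, ?_⟩
      rw [← Tableau.permute_permute, h, Tableau.permute_permute, inv_mul_cancel,
        Tableau.permute_one]
    obtain ⟨κ, hκ, hκC, rfl⟩ := huv.exists_mem_blockPerms hout
    have hκC' : κ • C = C := by
      ext c
      rw [← Finset.inv_smul_mem_iff]
      exact inv_mem hκC c
    have hσ : ρ⁻¹ * (π * κ) ∈ rowStab u := by
      refine ⟨mul_mem (inv_mem hρ) (mul_mem hπ hκ), hperm u ?_⟩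
      rw [← Tableau.permute_permute, ← Tableau.permute_permute, ← h, Tableau.permute_permute,
        inv_mul_cancel, Tableau.permute_one]
    refine ⟨_, ⟨⟨_, hσ⟩, rfl⟩, ?_⟩
    change ρ • ((ρ⁻¹ * (π * κ)) • C) = π • C
    rw [smul_smul, mul_inv_cancel_left, mul_smul, hκC']

variable {ι : Type*} [DecidableEq ι]

open scoped Pointwise in
/-- Dual Garnir relations vanish after antisymmetrising columns. Group the terms by the position `D`
of the moved block of boxes: `D` has two boxes in one column, and swapping their entries
pairs off the terms with opposite signs. -/
lemma sum_relIndex_smul_copolytabloid [Finite ι] (b : ι → V) {t : Tableau μ ι} {i i' : ℕ}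
    {A B : Finset μ.cells} {T : Finset (Tableau μ ι)} (hi : i < i')
    (hA : ∀ c ∈ A, c.1.1 = i) (hB : ∀ c ∈ B, c.1.1 = i')
    (hcard : μ.rowLen i < A.card + B.card)
    (hT : IsRowTransversal (blockOrbit t (A ∪ B)) T) :
    ∑ u ∈ T, ((blockPerms (A ∪ B)).relIndex (rowStab u) : R) • copolytabloid R b u = 0 := by
  classical
  let _ := Fintype.ofFinite ι
  set C := A ∪ B with hC
  let P : Tableau μ ι → Finset μ.cells → Prop := fun x D =>
    ∃ π ∈ rowPerms μ, ∃ v ∈ blockOrbit t C, x = v.permute π ∧ D = π • C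
  have h1 : ∀ u ∈ T, ((blockPerms C).relIndex (rowStab u) : R) • copolytabloid R b u =
      ∑ x ∈ rowOrbit u, ∑ D with P x D, colTabloid R (b ∘ x) := by
    intro u hu
    rw [copolytabloid, Finset.smul_sum]
    refine Finset.sum_congr rfl fun x hx => ?_
    have hset : {D | ∃ π ∈ rowPerms μ, ∃ v ∈ blockOrbit t C, x = v.permute π ∧ D = π • C} =
        (Finset.univ.filter (P x) : Set (Finset μ.cells)) := by
      ext D
      simp [P]
    rw [relIndex_eq_ncard (hT.1 u hu) (mem_rowOrbit.1 hx), Finset.sum_const, hset,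
      Set.ncard_coe_finset, Nat.cast_smul_eq_nsmul]
  rw [Finset.sum_congr rfl h1, hT.sum_rowOrbit, Finset.sum_comm' (t' := Finset.univ)
    (s' := fun D => Finset.univ.filter fun x => P x D)]
  swap
  · intro x D
    simp only [Finset.mem_filter, Finset.mem_univ, true_and, and_true, and_iff_right_iff_imp]
    rintro ⟨π, hπ, v, hv, rfl, rfl⟩
    exact ⟨v, hv, π, hπ, rfl⟩
  refine Finset.sum_eq_zero fun D _ => ?_
  by_cases hD : ∃ π ∈ rowPerms μ, D = π • C
  swap
  · refine Finset.sum_eq_zero fun x hx => absurd ?_ hD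
    obtain ⟨π, hπ, v, hv, h, h'⟩ := (Finset.mem_filter.1 hx).2
    exact ⟨π, hπ, h'⟩
  obtain ⟨c, hc, d, hd, hne, hcol⟩ : ∃ c ∈ D, ∃ d ∈ D, c ≠ d ∧ c.1.2 = d.1.2 := by
    obtain ⟨π, hπ, rfl⟩ := hD
    refine Finset.exists_ne_map_eq_of_card_lt_of_maps_to (t := Finset.range (μ.rowLen i)) ?_ ?_
    · rw [Finset.card_range, Finset.card_smul_finset, hC, Finset.card_union_of_disjoint]
      · exact hcard
      · refine Finset.disjoint_left.2 fun c hcA hcB => ?_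
        have := hA c hcA
        have := hB c hcB
        omega
    · intro c hc
      rw [Finset.mem_coe, ← Finset.inv_smul_mem_iff] at hc
      have hrow : i ≤ c.1.1 := by
        have h2 : (π⁻¹ c).1.1 = c.1.1 := inv_mem hπ c
        rcases Finset.mem_union.1 hc with h | h
        · have := hA _ h
          change (π⁻¹ c).1.1 = i at this
          omega
        · have := hB _ h
          change (π⁻¹ c).1.1 = i' at this
          omega
      rw [Finset.coe_range, Set.mem_Iio]
      exact (YoungDiagram.mem_iff_lt_rowLen.1 c.2).trans_le (μ.rowLen_anti _ _ hrow)
  refine Finset.sum_involution (fun x _ => x.permute (Equiv.swap c d)) ?_ ?_ ?_ ?_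
  · intro x _
    change _ + colTabloid R (Tableau.permute (b ∘ x) (Equiv.swap c d)) = 0
    rw [colTabloid_permute_swap R _ hcol hne, add_neg_cancel]
  · intro x _ hx h
    refine hx (colTabloid_eq_zero R hcol hne (congrArg b ?_))
    have := congrFun h c
    simpa [Tableau.permute] using this.symm
  · intro x hx
    simp only [Finset.mem_filter, Finset.mem_univ, true_and] at hx ⊢
    obtain ⟨π, hπ, _, ⟨τ, hτ, rfl⟩, rfl, rfl⟩ := hx
    refine ⟨π, hπ, (t.permute τ).permute (Equiv.swap (π⁻¹ c) (π⁻¹ d)),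
      ⟨Equiv.swap (π⁻¹ c) (π⁻¹ d) * τ, ?_, Tableau.permute_permute _ _ _⟩, ?_, rfl⟩
    · intro e he
      rw [← Finset.inv_smul_mem_iff] at hc hd
      rw [Equiv.Perm.mul_apply, hτ e he]
      refine Equiv.swap_apply_of_ne_of_ne ?_ ?_
      · rintro rfl; exact he hc
      · rintro rfl; exact he hd
    · rw [Tableau.permute_permute, Tableau.permute_permute, Tableau.permute_permute,
        Tableau.permute_permute, Equiv.mul_swap_eq_swap_mul]
      simp
  · intro x _
    rw [Tableau.permute_permute, Equiv.swap_mul_self, Tableau.permute_one]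

end Garnir

/-! ### Functionals on `Λ^{λ'} V` and on `Sym^λ V^*` -/

section Functionals

variable {μ : YoungDiagram} {R : Type*} [CommRing R] {V : Type*} [AddCommGroup V] [Module R V]

/-- The functional on `Λ^{λ'} V` attached to a tableau of functionals on `V`: the tensor product over
the columns of the functionals on exterior powers that a column of `f` defines by determinants. -/
noncomputable def columnFunctional (f : Tableau μ (Dual R V)) : ExtUpper R V μ →ₗ[R] R :=
  PiTensorProduct.lift ((MultilinearMap.mkPiAlgebra R (Fin (μ.rowLen 0)) R).compLinearMap
    fun j => exteriorPower.pairingDual R V (μ.colLen j)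
      (exteriorPower.ιMulti R (μ.colLen j) fun i => f (colCells μ ⟨j, i⟩)))

lemma det_blockDiagonal_sigma {o : Type*} [Fintype o] [LinearOrder o] {m : o → Type*}
    [∀ k, Fintype (m k)] [∀ k, DecidableEq (m k)] (d : ∀ k, Matrix (m k) (m k) R) :
    (Matrix.blockDiagonal' d).det = ∏ k, (d k).det := by
  rw [(Matrix.blockTriangular_blockDiagonal' d).det_fintype]
  refine Finset.prod_congr rfl fun k _ => ?_
  rw [← Matrix.det_submatrix_equiv_self (Equiv.sigmaSubtype k).symm]
  congr 1
  ext i j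
  exact Matrix.blockDiagonal'_apply_eq d k i j

/-- The product over the columns of the determinants is the determinant of a block diagonal matrix,
whose Leibniz expansion is a sum over the column-preserving permutations. -/
lemma columnFunctional_colTabloid (f : Tableau μ (Dual R V)) (v : Tableau μ V) :
    columnFunctional f (colTabloid R v) =
      ∑ σ : Equiv.Perm μ.cells with σ ∈ colPerms μ,
        ((Equiv.Perm.sign σ : ℤ) : R) * ∏ c, f c (v (σ c)) := by
  let N : Matrix μ.cells μ.cells R := Matrix.of fun c d => if c.1.2 = d.1.2 then f d (v c) else 0
  have hN : N.submatrix (colCells μ) (colCells μ) = Matrix.blockDiagonal'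
      fun j : Fin (μ.rowLen 0) => Matrix.of fun i k : Fin (μ.colLen j) =>
        f (colCells μ ⟨j, k⟩) (v (colCells μ ⟨j, i⟩)) := by
    ext ⟨j, i⟩ ⟨k, l⟩
    rw [Matrix.submatrix_apply, Matrix.blockDiagonal'_apply]
    by_cases h : j = k
    · subst h
      rw [dif_pos rfl]
      exact if_pos (show (colCells μ ⟨j, i⟩).1.2 = (colCells μ ⟨j, l⟩).1.2 from rfl)
    · rw [dif_neg h]
      exact if_neg fun h' => h (Fin.ext h')
  have hdet : columnFunctional f (colTabloid R v) = N.det := by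
    rw [← Matrix.det_submatrix_equiv_self (colCells μ), hN, det_blockDiagonal_sigma,
      columnFunctional, colTabloid, PiTensorProduct.lift.tprod,
      MultilinearMap.compLinearMap_apply, MultilinearMap.mkPiAlgebra_apply]
    exact Finset.prod_congr rfl fun j _ => exteriorPower.pairingDual_ιMulti_ιMulti _ _
  rw [hdet, Matrix.det_apply', Finset.sum_filter]
  refine Finset.sum_congr rfl fun σ _ => ?_
  by_cases h : σ ∈ colPerms μ
  · rw [if_pos h]
    congr 1
    exact Finset.prod_congr rfl fun c _ => if_pos (h c)
  · rw [if_neg h]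
    obtain ⟨c, hc⟩ := not_forall.1 h
    rw [Finset.prod_eq_zero (Finset.mem_univ c) (if_neg hc), mul_zero]

variable (μ) in
/-- The boxes of a Young diagram, listed row by row. -/
def rowCells : (Σ i : Fin (μ.colLen 0), Fin (μ.rowLen i)) ≃ μ.cells where
  toFun x := ⟨(x.1, x.2), μ.mem_iff_lt_rowLen.2 x.2.2⟩
  invFun c := ⟨⟨c.1.1, μ.mem_iff_lt_colLen.1 (μ.up_left_mem le_rfl (Nat.zero_le _) c.2)⟩,
    ⟨c.1.2, μ.mem_iff_lt_rowLen.1 c.2⟩⟩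
  left_inv _ := rfl
  right_inv _ := rfl

/-- Row equivalence, row by row. -/
lemma rowEquiv_iff_rows {X : Type*} {t u : Tableau μ X} :
    RowEquiv t u ↔ ∀ i : Fin (μ.colLen 0), ∃ τ : Equiv.Perm (Fin (μ.rowLen i)),
      (fun j => t (rowCells μ ⟨i, j⟩)) ∘ τ = fun j => u (rowCells μ ⟨i, j⟩) := by
  constructor
  · rintro ⟨σ, hσ, rfl⟩ i
    have hσ' : σ⁻¹ ∈ rowPerms μ := inv_mem hσ
    have hrow : ∀ j : Fin (μ.rowLen i), (σ⁻¹ (rowCells μ ⟨i, j⟩)).1.1 = i := fun j => hσ' _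
    let e : Fin (μ.rowLen i) → Fin (μ.rowLen i) := fun j =>
      ⟨(σ⁻¹ (rowCells μ ⟨i, j⟩)).1.2, by
        rw [← YoungDiagram.mem_iff_lt_rowLen]
        have h := (σ⁻¹ (rowCells μ ⟨i, j⟩)).2
        rw [← Prod.mk.eta (p := (σ⁻¹ (rowCells μ ⟨i, j⟩)).1), hrow] at h
        exact h⟩
    have he : ∀ j, rowCells μ ⟨i, e j⟩ = σ⁻¹ (rowCells μ ⟨i, j⟩) := fun j =>
      Subtype.ext (Prod.ext (hrow j).symm rfl)
    have hinj : Function.Injective e := by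
      intro j j' h
      have h1 : σ⁻¹ (rowCells μ ⟨i, j⟩) = σ⁻¹ (rowCells μ ⟨i, j'⟩) := by rw [← he, ← he, h]
      exact Fin.ext (congrArg (fun c : μ.cells => c.1.2) (σ⁻¹.injective h1))
    refine ⟨Equiv.ofBijective e (Finite.injective_iff_bijective.1 hinj), funext fun j => ?_⟩
    simp only [Function.comp_apply, Equiv.ofBijective_apply, he, Tableau.permute]
  · intro h
    choose τ hτ using h
    refine ⟨(rowCells μ).permCongr (Equiv.sigmaCongrRight τ)⁻¹, ?_, ?_⟩
    · intro c
      obtain ⟨⟨i, j⟩, rfl⟩ := (rowCells μ).surjective c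
      rw [Equiv.permCongr_apply, Equiv.symm_apply_apply]
      rfl
    · funext c
      obtain ⟨⟨i, j⟩, rfl⟩ := (rowCells μ).surjective c
      refine (congrFun (hτ i) j).symm.trans (congrArg t ?_)
      rw [Equiv.Perm.eq_inv_iff_eq, Equiv.permCongr_apply, Equiv.symm_apply_apply]
      exact congrArg (rowCells μ) (Equiv.symm_apply_apply (Equiv.sigmaCongrRight τ)
        (⟨i, j⟩ : Σ i : Fin (μ.colLen 0), Fin (μ.rowLen i)))

lemma rowTabloid_eq {v w : Tableau μ V} (h : RowEquiv v w) : rowTabloid R v = rowTabloid R w := by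
  rw [rowTabloid, rowTabloid]
  congr 1
  funext i
  obtain ⟨τ, hτ⟩ := rowEquiv_iff_rows.1 h i
  refine ((Submodule.Quotient.eq _).2 ?_).symm
  refine Submodule.subset_span ⟨PiTensorProduct.tprod R fun j => v (rowCells μ ⟨i, j⟩), τ⁻¹, ?_⟩
  rw [PiTensorProduct.reindex_tprod]
  congr 2
  exact hτ.symm

variable {ι : Type*} [DecidableEq ι]

/-- The functional on a symmetric power of `V^*` attached to a tuple `v` of basis indices: the sum
over the distinct rearrangements of `v` of the evaluations at the corresponding pure tensors. -/
noncomputable def symPowFunctional (b : ι → V) {n : ℕ} (v : Fin n → ι) :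
    SymPow R (Dual R V) n →ₗ[R] R :=
  Submodule.liftQ _ (∑ u ∈ Finset.univ.image fun τ : Equiv.Perm (Fin n) => v ∘ τ,
    PiTensorProduct.lift ((MultilinearMap.mkPiAlgebra R (Fin n) R).compLinearMap
      fun j => Dual.eval R V (b (u j)))) <| by
    rw [Submodule.span_le]
    rintro _ ⟨w, σ, rfl⟩
    rw [SetLike.mem_coe, LinearMap.mem_ker, map_sub, sub_eq_zero]
    refine LinearMap.congr_fun (f := _ ∘ₗ (PiTensorProduct.reindex R _ σ).toLinearMap)
      (PiTensorProduct.ext (MultilinearMap.ext fun f => ?_)) w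
    simp only [LinearMap.compMultilinearMap_apply, LinearMap.comp_apply, LinearEquiv.coe_coe,
      PiTensorProduct.reindex_tprod, LinearMap.sum_apply, PiTensorProduct.lift.tprod,
      MultilinearMap.compLinearMap_apply, MultilinearMap.mkPiAlgebra_apply, Dual.eval_apply]
    refine Finset.sum_bij' (fun u _ => u ∘ σ) (fun u _ => u ∘ σ.symm) ?_ ?_ ?_ ?_ ?_
    · intro u hu
      obtain ⟨τ, -, rfl⟩ := Finset.mem_image.1 hu
      exact Finset.mem_image.2 ⟨τ * σ, Finset.mem_univ _, rfl⟩
    · intro u hu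
      obtain ⟨τ, -, rfl⟩ := Finset.mem_image.1 hu
      exact Finset.mem_image.2 ⟨τ * σ⁻¹, Finset.mem_univ _, rfl⟩
    · intro u _; funext j; simp
    · intro u _; funext j; simp
    · intro u _
      rw [← Equiv.prod_comp σ]
      exact Finset.prod_congr rfl fun j _ => by rw [Equiv.symm_apply_apply]; rfl

lemma symPowFunctional_mk (b : ι → V) {n : ℕ} (v : Fin n → ι) (f : Fin n → Dual R V) :
    symPowFunctional b v (Submodule.Quotient.mk (PiTensorProduct.tprod R f)) =
      ∑ u ∈ Finset.univ.image fun τ : Equiv.Perm (Fin n) => v ∘ τ, ∏ j, f j (b (u j)) := by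
  rw [symPowFunctional]
  erw [Submodule.liftQ_apply]
  simp

/-- The functional on `Sym^λ V^*` attached to a tableau of basis indices.  On row tabloids of
dual basis vectors it is the indicator function of the row equivalence class of `t`. -/
noncomputable def rowFunctional (b : ι → V) (t : Tableau μ ι) :
    SymUpper R (Dual R V) μ →ₗ[R] R :=
  PiTensorProduct.lift ((MultilinearMap.mkPiAlgebra R (Fin (μ.colLen 0)) R).compLinearMap
    fun i => symPowFunctional b fun j => t (rowCells μ ⟨i, j⟩))

lemma rowFunctional_rowTabloid (b : ι → V) (t : Tableau μ ι) (f : Tableau μ (Dual R V)) :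
    rowFunctional b t (rowTabloid R f) = ∑ u ∈ rowOrbit t, ∏ c, f c (b (u c)) := by
  rw [rowFunctional, rowTabloid, PiTensorProduct.lift.tprod, MultilinearMap.compLinearMap_apply,
    MultilinearMap.mkPiAlgebra_apply]
  simp only [symPowFunctional_mk]
  rw [Finset.prod_univ_sum]
  refine Finset.sum_bij' (fun p _ c => p ((rowCells μ).symm c).1 ((rowCells μ).symm c).2)
    (fun u _ i j => u (rowCells μ ⟨i, j⟩)) ?_ ?_ ?_ ?_ ?_
  · intro p hp
    rw [mem_rowOrbit, rowEquiv_iff_rows]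
    intro i
    obtain ⟨τ, -, hτ⟩ := Finset.mem_image.1 (Fintype.mem_piFinset.1 hp i)
    exact ⟨τ, hτ⟩
  · intro u hu
    rw [mem_rowOrbit, rowEquiv_iff_rows] at hu
    rw [Fintype.mem_piFinset]
    intro i
    simpa using hu i
  · intro p _; rfl
  · intro u _; rfl
  · intro p _
    rw [← Equiv.prod_comp (rowCells μ), Fintype.prod_sigma]
    rfl

lemma rowFunctional_rowTabloid_dualBasis [Finite ι] (b : Basis ι R V) (s t : Tableau μ ι) :
    rowFunctional b t (rowTabloid R (b.dualBasis ∘ s)) = if s ∈ rowOrbit t then 1 else 0 := by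
  rw [rowFunctional_rowTabloid, ← Finset.sum_ite_eq' (rowOrbit t) s fun _ => (1 : R)]
  refine Finset.sum_congr rfl fun u _ => ?_
  simp only [Function.comp_apply, Basis.coe_dualBasis, Basis.coord_apply, Basis.repr_self,
    Finsupp.single_apply]
  split_ifs with h
  · subst h; simp
  · obtain ⟨c, hc⟩ := Function.ne_iff.1 h
    exact Finset.prod_eq_zero (Finset.mem_univ c) (if_neg hc)

/-- The functional of the row class of `t` takes the same value at the polytabloid of `f` as the
column functional of `f` at the copolytabloid of `t`. -/
lemma rowFunctional_polytabloid (b : ι → V) (t : Tableau μ ι) (f : Tableau μ (Dual R V)) :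
    rowFunctional b t (polytabloid R f) = columnFunctional f (copolytabloid R b t) := by
  rw [polytabloid, copolytabloid, map_sum, map_sum]
  simp only [map_smul, rowFunctional_rowTabloid, columnFunctional_colTabloid, smul_eq_mul,
    Finset.mul_sum]
  rw [Finset.sum_comm]
  refine Finset.sum_congr rfl fun u _ => Finset.sum_congr rfl fun σ _ => ?_
  rw [← Equiv.prod_comp σ]
  simp [Tableau.permute]

end Functionals

/-! ### The projection of row-symmetric tensors to column tabloids -/

section Projection

variable {μ : YoungDiagram} {R : Type*} [CommRing R] {V : Type*} [AddCommGroup V] [Module R V]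

variable (μ R V) in
/-- The projection `V^{⊗ |λ|} → Λ^{λ'} V`. -/
noncomputable def colProj : (⨂[R] _ : μ.cells, V) →ₗ[R] ExtUpper R V μ :=
  PiTensorProduct.lift (colTabloidMultilinear μ R V)

lemma colProj_tprod (v : Tableau μ V) : colProj μ R V (PiTensorProduct.tprod R v) = colTabloid R v :=
  PiTensorProduct.lift.tprod v

variable (μ R V) in
/-- The restriction to `Sym_λ V` of the projection `V^{⊗ |λ|} → Λ^{λ'} V`. -/
noncomputable def symProj : SymLower R V μ →ₗ[R] ExtUpper R V μ :=
  colProj μ R V ∘ₗ (SymLower R V μ).subtype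

variable {G : Type*} [Group G] (ρ : Representation R G V)

lemma extUpperRep_colTabloid (g : G) (v : Tableau μ V) :
    extUpperRep R ρ μ g (colTabloid R v) = colTabloid R fun c => ρ g (v c) := by
  rw [extUpperRep, colTabloid, piTensorRep_tprod, colTabloid]
  congr 1
  funext j
  exact exteriorPower.map_apply_ιMulti _ _

lemma extUpperRep_colProj (g : G) (w : ⨂[R] _ : μ.cells, V) :
    extUpperRep R ρ μ g (colProj μ R V w) =
      colProj μ R V (piTensorRep R (fun _ => ρ) g w) := by
  refine LinearMap.congr_fun (f := extUpperRep R ρ μ g ∘ₗ colProj μ R V)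
    (g := colProj μ R V ∘ₗ piTensorRep R (fun _ => ρ) g)
    (PiTensorProduct.ext (MultilinearMap.ext fun v => ?_)) w
  simp only [LinearMap.compMultilinearMap_apply, LinearMap.comp_apply, piTensorRep_tprod]
  rw [colProj_tprod, colProj_tprod]
  exact extUpperRep_colTabloid ρ g v

lemma extUpperRep_symProj (g : G) (w : SymLower R V μ) :
    extUpperRep R ρ μ g (symProj μ R V w) = symProj μ R V (symLowerRep R ρ μ g w) :=
  extUpperRep_colProj ρ g w.1

/-- The group acts on the pairing of `Λ^{λ'} V` with tableaux of functionals contragrediently. -/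
lemma columnFunctional_extUpperRep (f : Tableau μ (Dual R V)) (g : G) (w : SymLower R V μ) :
    columnFunctional f (extUpperRep R ρ μ g (symProj μ R V w)) =
      columnFunctional (fun c => ρ.dual g⁻¹ (f c)) (symProj μ R V w) := by
  refine LinearMap.congr_fun
    (f := columnFunctional f ∘ₗ extUpperRep R ρ μ g ∘ₗ colProj μ R V)
    (g := columnFunctional (fun c => ρ.dual g⁻¹ (f c)) ∘ₗ colProj μ R V)
    (PiTensorProduct.ext (MultilinearMap.ext fun v => ?_)) w.1
  simp only [LinearMap.compMultilinearMap_apply, LinearMap.comp_apply]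
  rw [colProj_tprod, extUpperRep_colTabloid, columnFunctional_colTabloid,
    columnFunctional_colTabloid]
  simp [Dual.transpose_apply]

variable {ι : Type*} [DecidableEq ι]

lemma symProj_rowSym (b : ι → V) (t : Tableau μ ι) :
    symProj μ R V (rowSym b t) = copolytabloid R b t := by
  rw [symProj, LinearMap.comp_apply, Submodule.subtype_apply, rowSym, map_sum, copolytabloid]
  exact Finset.sum_congr rfl fun u _ => colProj_tprod _

variable [Finite ι] (b : Basis ι R V)

lemma range_symProj : LinearMap.range (symProj μ R V) = copolytab b μ := by
  rw [LinearMap.range_eq_map, ← span_rowSym b μ, Submodule.map_span, ← Set.range_comp, copolytab]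
  exact congrArg (fun f => Submodule.span R (Set.range f)) (funext fun t => symProj_rowSym _ t)

lemma dualGarnir_le_ker_symProj : dualGarnir b μ ≤ LinearMap.ker (symProj μ R V) := by
  rw [dualGarnir, Submodule.span_le]
  rintro _ ⟨t, i, i', A, B, T, hi, hA, hB, hcard, hT, rfl⟩
  rw [SetLike.mem_coe, LinearMap.mem_ker, dualGarnirRel, map_sum]
  simp only [← Nat.cast_smul_eq_nsmul R, map_smul, symProj_rowSym]
  exact sum_relIndex_smul_copolytabloid R b hi hA hB hcard hT

end Projection

/-! ### The unitriangular matrix of pairings of semistandard tableaux -/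

section Unitriangular

variable {μ : YoungDiagram} {R : Type*} [CommRing R] {V : Type*} [AddCommGroup V] [Module R V]
  {ι : Type*} [DecidableEq ι] [Finite ι] (b : Basis ι R V) {r : ι → ℕ}

lemma rowFunctional_polytabloid_dualBasis (s t : Tableau μ ι) :
    rowFunctional b t (polytabloid R (b.dualBasis ∘ s)) =
      ∑ σ : Equiv.Perm μ.cells with σ ∈ colPerms μ,
        ((Equiv.Perm.sign σ : ℤ) : R) * if s.permute σ ∈ rowOrbit t then 1 else 0 := by
  rw [polytabloid, map_sum]
  refine Finset.sum_congr rfl fun σ _ => ?_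
  rw [map_smul, smul_eq_mul, ← rowFunctional_rowTabloid_dualBasis b]
  rfl

variable {b} in
lemma rowEquiv_or_weight_lt_of_rowFunctional_ne_zero {s t : Tableau μ ι} (hs : IsSemistandard r s)
    (h : rowFunctional b t (polytabloid R (b.dualBasis ∘ s)) ≠ 0) :
    RowEquiv t s ∨ weight r t < weight r s := by
  rw [rowFunctional_polytabloid_dualBasis] at h
  obtain ⟨σ, hσ, hne⟩ := Finset.exists_ne_zero_of_sum_ne_zero h
  have hmem : s.permute σ ∈ rowOrbit t := by
    by_contra h'
    rw [if_neg h', mul_zero] at hne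
    exact hne rfl
  rw [mem_rowOrbit] at hmem
  by_cases h1 : σ = 1
  · subst h1
    exact Or.inl hmem
  · right
    rw [hmem.weight_eq]
    exact hs.weight_permute_lt (by simpa using hσ) h1

lemma rowFunctional_polytabloid_self {s : Tableau μ ι} (hs : IsSemistandard r s) :
    rowFunctional b s (polytabloid R (b.dualBasis ∘ s)) = 1 := by
  rw [rowFunctional_polytabloid_dualBasis, Finset.sum_eq_single 1]
  · rw [Tableau.permute_one, if_pos (mem_rowOrbit.2 (RowEquiv.refl s))]
    simp
  · intro σ hσ h1
    rw [if_neg, mul_zero]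
    intro h
    have h2 := hs.weight_permute_lt (by simpa using hσ) h1
    rw [(mem_rowOrbit.1 h).weight_eq] at h2
    exact h2.false
  · intro h
    exact absurd (by simp [one_mem]) h

/-- The matrix of the pairings of row classes with polytabloids, both labelled by a set `T` of
tableaux. -/
noncomputable def pairingMatrix (T : Finset (Tableau μ ι)) : Matrix T T R :=
  Matrix.of fun t s => rowFunctional b t.1 (polytabloid R (b.dualBasis ∘ s.1))

/-- On representatives of the semistandard tableaux the matrix of pairings is unitriangular with
respect to the weight. -/
lemma det_pairingMatrix {T : Finset (Tableau μ ι)}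
    (hT : IsRowTransversal {s | IsSemistandard r s} T) : (pairingMatrix b T).det = 1 := by
  have htri : (pairingMatrix b T).BlockTriangular fun t => weight r t.1 := by
    intro t s hlt
    by_contra h
    rcases rowEquiv_or_weight_lt_of_rowFunctional_ne_zero (hT.1 s.1 s.2) h with h' | h'
    · exact (hlt.trans_eq h'.weight_eq).false
    · exact (hlt.trans h').false
  rw [htri.det]
  refine Finset.prod_eq_one fun a _ => ?_
  suffices h1 : (pairingMatrix b T).toSquareBlock (fun t => weight r t.1) a = 1 by
    rw [h1, Matrix.det_one]
  ext ⟨t, ht⟩ ⟨s, hs⟩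
  rw [Matrix.toSquareBlock_def, Matrix.of_apply, Matrix.one_apply]
  split_ifs with h
  · obtain rfl : t = s := congrArg Subtype.val h
    exact rowFunctional_polytabloid_self b (hT.1 t.1 t.2)
  · by_contra hne
    rcases rowEquiv_or_weight_lt_of_rowFunctional_ne_zero (hT.1 s.1 s.2) hne with h' | h'
    · refine h (Subtype.ext (Subtype.ext ?_))
      obtain ⟨w, -, hw⟩ := hT.2 t.1 (hT.1 _ t.2)
      exact (hw _ ⟨t.2, RowEquiv.refl _⟩).trans (hw _ ⟨s.2, h'⟩).symm
    · exact (h'.trans_eq (hs.trans ht.symm)).false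

lemma isUnit_det_pairingMatrix {T : Finset (Tableau μ ι)}
    (hT : IsRowTransversal {s | IsSemistandard r s} T) : IsUnit (pairingMatrix b T).det := by
  rw [det_pairingMatrix b hT]
  exact isUnit_one

/-- Every row-symmetric tensor is, modulo the dual Garnir relations, a linear combination of the row
symmetrisations of representatives of the semistandard tableaux. -/
lemma exists_sub_sum_rowSym_mem_dualGarnir (hr : Function.Injective r) {T : Finset (Tableau μ ι)}
    (hT : IsRowTransversal {s | IsSemistandard r s} T) (w : SymLower R V μ) :
    ∃ a : T → R, w - ∑ s, a s • (rowSym b s.1 : SymLower R V μ) ∈ dualGarnir b μ := by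
  have hle : (⊤ : Submodule R (SymLower R V μ)) ≤
      Submodule.span R (Set.range fun s : T => (rowSym b s.1 : SymLower R V μ)) ⊔
        dualGarnir b μ := by
    rw [← span_rowSym b μ, Submodule.span_le]
    rintro _ ⟨t, rfl⟩
    refine SetLike.le_def.1 (sup_le_sup_right (Submodule.span_le.2 ?_) _)
      (rowSym_mem_span_semistandard b hr t)
    rintro _ ⟨s, hs, rfl⟩
    obtain ⟨u, ⟨hu, hsu⟩, -⟩ := hT.2 s hs
    exact Submodule.subset_span ⟨⟨u, hu⟩, (rowSym_eq b hsu).symm⟩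
  obtain ⟨x, hx, y, hy, rfl⟩ := Submodule.mem_sup.1 (hle (Submodule.mem_top (x := w)))
  obtain ⟨a, rfl⟩ := (Submodule.mem_span_range_iff_exists_fun R).1 hx
  exact ⟨a, by rwa [add_sub_cancel_left]⟩

end Unitriangular

/-! ### Separation and extension of functionals -/

section Separation

variable {μ : YoungDiagram} {R : Type*} [CommRing R] {V : Type*} [AddCommGroup V] [Module R V]
  {ι : Type*} [DecidableEq ι]

lemma rowFunctional_polytabloid_eq_symProj (b : ι → V) (t : Tableau μ ι)
    (f : Tableau μ (Dual R V)) :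
    rowFunctional b t (polytabloid R f) = columnFunctional f (symProj μ R V (rowSym b t)) := by
  rw [rowFunctional_polytabloid, symProj_rowSym]

variable [Finite ι] (b : Basis ι R V) {r : ι → ℕ}

/-- A row-symmetric tensor that pairs to zero with all tableaux of dual basis vectors is a combination
of dual Garnir relations. -/
lemma mem_dualGarnir_of_columnFunctional_eq_zero (w : SymLower R V μ)
    (hw : ∀ s : Tableau μ ι, columnFunctional (b.dualBasis ∘ s) (symProj μ R V w) = 0) :
    w ∈ dualGarnir b μ := by
  obtain ⟨r, hr⟩ : ∃ r : ι → ℕ, Function.Injective r :=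
    ⟨fun i => (Finite.equivFin ι i : ℕ), fun i j h => (Finite.equivFin ι).injective (Fin.ext h)⟩
  obtain ⟨T, hT⟩ := exists_isRowTransversal {s : Tableau μ ι | IsSemistandard r s}
  obtain ⟨a, ha⟩ := exists_sub_sum_rowSym_mem_dualGarnir b hr hT w
  have hsym := LinearMap.mem_ker.1 (dualGarnir_le_ker_symProj b ha)
  rw [map_sub, sub_eq_zero] at hsym
  have haM : Matrix.vecMul a (pairingMatrix b T) = 0 := by
    funext s
    have h := hw s.1
    rw [hsym, map_sum, map_sum] at h
    rw [Pi.zero_apply, ← h]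
    refine Finset.sum_congr rfl fun t _ => ?_
    rw [map_smul, map_smul, ← rowFunctional_polytabloid_eq_symProj]
    rfl
  have ha0 : a = 0 := by
    have hunit := isUnit_det_pairingMatrix b hT
    rw [← Matrix.vecMul_one a, ← Matrix.mul_nonsing_inv _ hunit, ← Matrix.vecMul_vecMul, haM,
      Matrix.zero_vecMul]
  simpa [ha0] using ha

/-- The functionals of the row classes separate the elements of `Sym^λ V^*`, here expressed on the
span of the row tabloids of the dual basis. -/
lemma eq_of_rowFunctional_eq {x y : SymUpper R (Dual R V) μ}
    (hx : x ∈ Submodule.span R (Set.range fun s : Tableau μ ι => rowTabloid R (b.dualBasis ∘ s)))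
    (hy : y ∈ Submodule.span R (Set.range fun s : Tableau μ ι => rowTabloid R (b.dualBasis ∘ s)))
    (h : ∀ t : Tableau μ ι, rowFunctional b t x = rowFunctional b t y) : x = y := by
  obtain ⟨T, hT⟩ := exists_isRowTransversal (Set.univ : Set (Tableau μ ι))
  let L : SymUpper R (Dual R V) μ →ₗ[R] SymUpper R (Dual R V) μ :=
    ∑ t ∈ T, (rowFunctional b t).smulRight (rowTabloid R (b.dualBasis ∘ t))
  have hL : Set.EqOn (LinearMap.id : SymUpper R (Dual R V) μ →ₗ[R] SymUpper R (Dual R V) μ) L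
      (Set.range fun s : Tableau μ ι => rowTabloid R (b.dualBasis ∘ s)) := by
    rintro _ ⟨s, rfl⟩
    obtain ⟨t, ⟨htT, hst⟩, huniq⟩ := hT.2 s trivial
    simp only [L, LinearMap.sum_apply, LinearMap.smulRight_apply,
      rowFunctional_rowTabloid_dualBasis]
    rw [Finset.sum_eq_single t]
    · rw [if_pos (mem_rowOrbit.2 hst.symm), one_smul]
      obtain ⟨σ, hσ, rfl⟩ := hst
      exact rowTabloid_eq ⟨σ, hσ, rfl⟩
    · intro u huT hut
      rw [if_neg, zero_smul]
      intro h
      exact hut (huniq u ⟨huT, (mem_rowOrbit.1 h).symm⟩)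
    · exact fun h => absurd htT h
  have hLx := LinearMap.eqOn_span hL hx
  have hLy := LinearMap.eqOn_span hL hy
  rw [LinearMap.id_apply] at hLx hLy
  rw [hLx, hLy]
  simp only [L, LinearMap.sum_apply, LinearMap.smulRight_apply, h]

/-- The polytabloids of representatives of the semistandard tableaux span all polytabloids.  This
is deduced from the straightening of row symmetrisations: functionals of row classes are
combinations of the semistandard ones, and on these the matrix of pairings is invertible. -/
lemma polytabloid_mem_span_semistandard (hr : Function.Injective r) {T : Finset (Tableau μ ι)}
    (hT : IsRowTransversal {s | IsSemistandard r s} T) (s' : Tableau μ ι) :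
    polytabloid R (b.dualBasis ∘ s') ∈
      Submodule.span R (Set.range fun s : T => polytabloid R (b.dualBasis ∘ s.1)) := by
  have hunit := isUnit_det_pairingMatrix b hT
  let z : T → R := fun t => rowFunctional b t.1 (polytabloid R (b.dualBasis ∘ s'))
  let y : T → R := Matrix.mulVec (pairingMatrix b T)⁻¹ z
  have hy : Matrix.mulVec (pairingMatrix b T) y = z := by
    rw [Matrix.mulVec_mulVec, Matrix.mul_nonsing_inv _ hunit, Matrix.one_mulVec]
  let x : SymUpper R (Dual R V) μ := ∑ s : T, y s • polytabloid R (b.dualBasis ∘ s.1)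
  have hT0 : ∀ t : T, rowFunctional b t.1 (polytabloid R (b.dualBasis ∘ s')) =
      rowFunctional b t.1 x := by
    intro t
    rw [map_sum]
    refine (congrFun hy t).symm.trans (Finset.sum_congr rfl fun s _ => ?_)
    rw [map_smul, smul_eq_mul, mul_comm]
    rfl
  have hcomb : ∀ t : Tableau μ ι, ∃ a : T → R, ∀ f : Tableau μ (Dual R V),
      rowFunctional b t (polytabloid R f) = (∑ u, a u • rowFunctional b u.1) (polytabloid R f) := by
    intro t
    obtain ⟨a, ha⟩ := exists_sub_sum_rowSym_mem_dualGarnir b hr hT (rowSym b t)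
    refine ⟨a, fun f => ?_⟩
    have h := LinearMap.mem_ker.1 (dualGarnir_le_ker_symProj b ha)
    rw [map_sub, sub_eq_zero] at h
    rw [rowFunctional_polytabloid_eq_symProj, h, map_sum, map_sum, LinearMap.sum_apply]
    refine Finset.sum_congr rfl fun u _ => ?_
    rw [map_smul, map_smul, LinearMap.smul_apply, rowFunctional_polytabloid_eq_symProj]
  have hpoly : ∀ s : Tableau μ ι, polytabloid R (b.dualBasis ∘ s) ∈
      Submodule.span R (Set.range fun s : Tableau μ ι => rowTabloid R (b.dualBasis ∘ s)) :=
    fun s => Submodule.sum_mem _ fun σ _ => Submodule.smul_mem _ _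
      (Submodule.subset_span ⟨s.permute σ, rfl⟩)
  have hx : polytabloid R (b.dualBasis ∘ s') = x := by
    refine eq_of_rowFunctional_eq b (hpoly s') (Submodule.sum_mem _ fun s _ =>
      Submodule.smul_mem _ _ (hpoly s.1)) fun t => ?_
    obtain ⟨a, ha⟩ := hcomb t
    have h : rowFunctional b t x = (∑ u, a u • rowFunctional b u.1) x := by
      simp only [x, map_sum, map_smul, ha]
    rw [h, ha, LinearMap.sum_apply, LinearMap.sum_apply]
    exact Finset.sum_congr rfl fun u _ => by rw [LinearMap.smul_apply, LinearMap.smul_apply, hT0]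
  rw [hx]
  exact Submodule.sum_mem _ fun s _ => Submodule.smul_mem _ _ (Submodule.subset_span ⟨s, rfl⟩)

variable {G : Type*} [Group G] (ρ : Representation R G V)

lemma polytabloid_mem_polytab (f : Tableau μ (Dual R V)) :
    polytabloid R f ∈ (polytab R ρ.dual μ).toSubmodule :=
  Submodule.subset_span ⟨f, rfl⟩

/-- Every functional on the Schur endofunctor of `V^*` is the pairing with some row-symmetric
tensor.  Its coefficients are found by inverting the matrix of pairings, so that the two agree on
the semistandard polytabloids, which span. -/
lemma exists_symLower_of_functional (b : Basis ι R V)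
    (F : Dual R (polytab R ρ.dual μ).toSubmodule) :
    ∃ w : SymLower R V μ, ∀ f : Tableau μ (Dual R V),
      F ⟨polytabloid R f, polytabloid_mem_polytab ρ f⟩ = columnFunctional f (symProj μ R V w) := by
  obtain ⟨r, hr⟩ : ∃ r : ι → ℕ, Function.Injective r :=
    ⟨fun i => (Finite.equivFin ι i : ℕ), fun i j h => (Finite.equivFin ι).injective (Fin.ext h)⟩
  obtain ⟨T, hT⟩ := exists_isRowTransversal {s : Tableau μ ι | IsSemistandard r s}
  have hunit := isUnit_det_pairingMatrix b hT
  let y : T → R := fun s => F ⟨_, polytabloid_mem_polytab ρ (b.dualBasis ∘ s.1)⟩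
  let a : T → R := Matrix.vecMul y (pairingMatrix b T)⁻¹
  have ha : Matrix.vecMul a (pairingMatrix b T) = y := by
    rw [Matrix.vecMul_vecMul, Matrix.nonsing_inv_mul _ hunit, Matrix.vecMul_one]
  let θ : Dual R (SymUpper R (Dual R V) μ) := ∑ t, a t • rowFunctional b t.1
  have hspan : (polytab R ρ.dual μ).toSubmodule ≤
      Submodule.span R (Set.range fun s : T => polytabloid R (b.dualBasis ∘ s.1)) := by
    rw [polytab_eq_span_basis R ρ.dual b.dualBasis, Submodule.span_le]
    rintro _ ⟨s, rfl⟩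
    exact polytabloid_mem_span_semistandard b hr hT s
  have hagree : ∀ x (hx : x ∈ (polytab R ρ.dual μ).toSubmodule), F ⟨x, hx⟩ = θ x := by
    intro x hx
    obtain ⟨c, rfl⟩ := (Submodule.mem_span_range_iff_exists_fun R).1 (hspan hx)
    have h : (⟨_, hx⟩ : (polytab R ρ.dual μ).toSubmodule) =
        ∑ s : T, c s • ⟨_, polytabloid_mem_polytab ρ (b.dualBasis ∘ s.1)⟩ :=
      Subtype.ext (by simp)
    rw [h, map_sum, map_sum]
    refine Finset.sum_congr rfl fun s _ => ?_
    rw [map_smul, map_smul]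
    congr 1
    refine (congrFun ha s).symm.trans ?_
    rw [LinearMap.sum_apply]
    rfl
  refine ⟨∑ t, a t • rowSym b t.1, fun f => ?_⟩
  rw [hagree, LinearMap.sum_apply, map_sum, map_sum]
  refine Finset.sum_congr rfl fun t _ => ?_
  rw [map_smul, map_smul, LinearMap.smul_apply, rowFunctional_polytabloid_eq_symProj]

end Separation

/-! ### The isomorphisms -/

section Isomorphisms

variable (μ : YoungDiagram) {R : Type*} [CommRing R] {V : Type*} [AddCommGroup V] [Module R V]
  {ι : Type*} [DecidableEq ι] [Finite ι] (b : Basis ι R V)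
  {G : Type*} [Group G] (ρ : Representation R G V)

/-- The values of a functional on the Schur endofunctor of `V^*` at all polytabloids. -/
noncomputable def polytabloidValues :
    Dual R (polytab R ρ.dual μ).toSubmodule →ₗ[R] Tableau μ (Dual R V) → R :=
  LinearMap.pi fun f => Dual.eval R _ ⟨polytabloid R f, polytabloid_mem_polytab ρ f⟩

/-- The pairings of a combination of copolytabloids with all tableaux of functionals. -/
noncomputable def columnValues : copolytab b μ →ₗ[R] Tableau μ (Dual R V) → R :=
  LinearMap.pi fun f => columnFunctional f ∘ₗ (copolytab b μ).subtype

variable (R V) in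
/-- The pairings of the column projection of a row-symmetric tensor with all tableaux of
functionals. -/
noncomputable def tensorValues : SymLower R V μ →ₗ[R] Tableau μ (Dual R V) → R :=
  LinearMap.pi fun f => columnFunctional f ∘ₗ symProj μ R V

variable {μ}

lemma polytabloidValues_injective : Function.Injective (polytabloidValues μ ρ) := by
  intro F F' h
  refine LinearMap.ext fun ⟨x, hx⟩ => ?_
  refine Submodule.span_induction (p := fun x hx => F ⟨x, hx⟩ = F' ⟨x, hx⟩) ?_ ?_ ?_ ?_ hx
  · rintro _ ⟨f, rfl⟩
    exact congrFun h f
  · exact (map_zero F).trans (map_zero F').symm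
  · intro x y hx hy h1 h2
    exact (map_add F ⟨x, hx⟩ ⟨y, hy⟩).trans
      ((congrArg₂ (· + ·) h1 h2).trans (map_add F' ⟨x, hx⟩ ⟨y, hy⟩).symm)
  · intro c x hx h1
    exact (map_smul F c ⟨x, hx⟩).trans
      ((congrArg (c • ·) h1).trans (map_smul F' c ⟨x, hx⟩).symm)

lemma exists_symProj_eq {x : ExtUpper R V μ} (hx : x ∈ copolytab b μ) :
    ∃ w, symProj μ R V w = x := by
  rwa [← range_symProj b] at hx

lemma symProj_mem_copolytab (w : SymLower R V μ) : symProj μ R V w ∈ copolytab b μ := by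
  rw [← range_symProj b]
  exact ⟨w, rfl⟩

lemma ker_tensorValues : LinearMap.ker (tensorValues μ R V) = dualGarnir b μ := by
  refine le_antisymm (fun w hw => mem_dualGarnir_of_columnFunctional_eq_zero b w fun s =>
    congrFun (LinearMap.mem_ker.1 hw) _) fun w hw => LinearMap.mem_ker.2 (funext fun f => ?_)
  have h := LinearMap.mem_ker.1 (dualGarnir_le_ker_symProj b hw)
  change columnFunctional f (symProj μ R V w) = 0
  rw [h, map_zero]

lemma columnValues_injective : Function.Injective (columnValues μ b) := by
  rintro ⟨x, hx⟩ ⟨y, hy⟩ h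
  obtain ⟨v, rfl⟩ := exists_symProj_eq b hx
  obtain ⟨w, rfl⟩ := exists_symProj_eq b hy
  have hvw : v - w ∈ LinearMap.ker (tensorValues μ R V) := by
    rw [LinearMap.mem_ker, map_sub, sub_eq_zero]
    exact h
  rw [ker_tensorValues b] at hvw
  have h' := LinearMap.mem_ker.1 (dualGarnir_le_ker_symProj b hvw)
  rw [map_sub, sub_eq_zero] at h'
  exact Subtype.ext h'

lemma range_columnValues :
    LinearMap.range (columnValues μ b) = LinearMap.range (tensorValues μ R V) := by
  apply le_antisymm
  · rintro _ ⟨⟨x, hx⟩, rfl⟩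
    obtain ⟨w, rfl⟩ := exists_symProj_eq b hx
    exact ⟨w, rfl⟩
  · rintro _ ⟨w, rfl⟩
    exact ⟨⟨_, symProj_mem_copolytab b w⟩, rfl⟩

lemma range_polytabloidValues (b : Basis ι R V) :
    LinearMap.range (polytabloidValues μ ρ) = LinearMap.range (tensorValues μ R V) := by
  apply le_antisymm
  · rintro _ ⟨F, rfl⟩
    obtain ⟨w, hw⟩ := exists_symLower_of_functional ρ b F
    exact ⟨w, funext fun f => (hw f).symm⟩
  · rw [LinearMap.range_eq_map, ← span_rowSym b μ, Submodule.map_le_iff_le_comap,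
      Submodule.span_le]
    rintro _ ⟨t, rfl⟩
    exact ⟨(rowFunctional b t).domRestrict _,
      funext fun f => rowFunctional_polytabloid_eq_symProj b t f⟩

variable (μ)

/-- The isomorphism from the Weyl endofunctor to the space of copolytabloids that matches the values
at polytabloids with the column pairings. -/
noncomputable def weylEquivCopolytab :
    Dual R (polytab R ρ.dual μ).toSubmodule ≃ₗ[R] copolytab b μ :=
  (LinearEquiv.ofInjective (polytabloidValues μ ρ) (polytabloidValues_injective ρ)).trans
    ((LinearEquiv.ofEq _ _ ((range_polytabloidValues ρ b).trans (range_columnValues b).symm)).trans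
      (LinearEquiv.ofInjective (columnValues μ b) (columnValues_injective b)).symm)

/-- The isomorphism from the quotient by the dual Garnir relations to the space of copolytabloids
that is induced by the projection to column tabloids. -/
noncomputable def quotientEquivCopolytab : (SymLower R V μ ⧸ dualGarnir b μ) ≃ₗ[R] copolytab b μ :=
  (Submodule.quotEquivOfEq _ _ (ker_tensorValues b).symm).trans
    ((tensorValues μ R V).quotKerEquivRange.trans
      ((LinearEquiv.ofEq _ _ (range_columnValues b).symm).trans
        (LinearEquiv.ofInjective (columnValues μ b) (columnValues_injective b)).symm))

variable {μ}

lemma columnFunctional_weylEquivCopolytab (F : Dual R (polytab R ρ.dual μ).toSubmodule)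
    (f : Tableau μ (Dual R V)) :
    columnFunctional f (weylEquivCopolytab μ b ρ F : ExtUpper R V μ) =
      F ⟨polytabloid R f, polytabloid_mem_polytab ρ f⟩ :=
  congrFun (congrArg Subtype.val ((LinearEquiv.ofInjective (columnValues μ b)
    (columnValues_injective b)).apply_symm_apply (LinearEquiv.ofEq _ _
      ((range_polytabloidValues ρ b).trans (range_columnValues b).symm)
        (LinearEquiv.ofInjective (polytabloidValues μ ρ) (polytabloidValues_injective ρ) F)))) f

lemma quotientEquivCopolytab_mk (w : SymLower R V μ) :
    quotientEquivCopolytab μ b (Submodule.Quotient.mk w) =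
      ⟨symProj μ R V w, symProj_mem_copolytab b w⟩ := by
  refine (LinearEquiv.ofInjective (columnValues μ b) (columnValues_injective b)).symm_apply_eq.2 ?_
  exact Subtype.ext rfl

lemma copolytab_ext {x y : copolytab b μ}
    (h : ∀ f, columnFunctional f (x : ExtUpper R V μ) = columnFunctional f (y : ExtUpper R V μ)) :
    x = y :=
  columnValues_injective b (funext h)

lemma extUpperRep_mem_copolytab (g : G) {x : ExtUpper R V μ} (hx : x ∈ copolytab b μ) :
    extUpperRep R ρ μ g x ∈ copolytab b μ := by
  obtain ⟨w, rfl⟩ := exists_symProj_eq b hx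
  rw [extUpperRep_symProj]
  exact symProj_mem_copolytab b _

lemma dualGarnir_le_comap (g : G) :
    dualGarnir b μ ≤ (dualGarnir b μ).comap (symLowerRep R ρ μ g) := by
  intro w hw
  rw [Submodule.mem_comap, ← ker_tensorValues b, LinearMap.mem_ker]
  funext f
  change columnFunctional f (symProj μ R V (symLowerRep R ρ μ g w)) = 0
  rw [← extUpperRep_symProj, LinearMap.mem_ker.1 (dualGarnir_le_ker_symProj b hw), map_zero,
    map_zero]

lemma schurRep_polytabloid (g : G) (f : Tableau μ (Dual R V)) :
    schurRep R ρ.dual μ g ⟨polytabloid R f, polytabloid_mem_polytab ρ f⟩ =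
      ⟨polytabloid R fun c => ρ.dual g (f c), polytabloid_mem_polytab ρ _⟩ := by
  refine Subtype.ext ?_
  change symUpperRep R ρ.dual μ g (polytabloid R f) = polytabloid R fun c => ρ.dual g (f c)
  rw [polytabloid, polytabloid, map_sum]
  refine Finset.sum_congr rfl fun σ _ => ?_
  rw [map_smul, symUpperRep_rowTabloid]
  rfl

lemma columnFunctional_weylRep (g : G) (F : Dual R (polytab R ρ.dual μ).toSubmodule)
    (f : Tableau μ (Dual R V)) :
    columnFunctional f (weylEquivCopolytab μ b ρ (weylRep R ρ μ g F) : ExtUpper R V μ) =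
      columnFunctional f (extUpperRep R ρ μ g (weylEquivCopolytab μ b ρ F : ExtUpper R V μ)) := by
  obtain ⟨w, hw⟩ := exists_symProj_eq b (weylEquivCopolytab μ b ρ F).2
  have h := columnFunctional_extUpperRep ρ f g w
  rw [hw] at h
  exact (columnFunctional_weylEquivCopolytab b ρ (weylRep R ρ μ g F) f).trans
    ((congrArg F (schurRep_polytabloid ρ g⁻¹ f)).trans
      ((columnFunctional_weylEquivCopolytab b ρ F fun c => ρ.dual g⁻¹ (f c)).symm.trans h.symm))

lemma weylEquivCopolytab_weylRep (g : G) (F : Dual R (polytab R ρ.dual μ).toSubmodule) :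
    weylEquivCopolytab μ b ρ (weylRep R ρ μ g F) =
      ⟨extUpperRep R ρ μ g (weylEquivCopolytab μ b ρ F : ExtUpper R V μ),
        extUpperRep_mem_copolytab b ρ g (weylEquivCopolytab μ b ρ F).2⟩ :=
  copolytab_ext b (columnFunctional_weylRep b ρ g F)

end Isomorphisms

end WeylModel

theorem theorem1p3 {R G V ι : Type*} [CommRing R] [Group G] [AddCommGroup V] [Module R V]
    [Finite ι] [DecidableEq ι] (b : Module.Basis ι R V) (ρ : Representation R G V)
    (μ : YoungDiagram) :
    ∃ (hC : ∀ g, ∀ x ∈ WeylModel.copolytab b μ,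
          WeylModel.extUpperRep R ρ μ g x ∈ WeylModel.copolytab b μ)
      (hD : ∀ g, WeylModel.dualGarnir b μ ≤
          (WeylModel.dualGarnir b μ).comap (WeylModel.symLowerRep R ρ μ g))
      (φ : (WeylModel.weylRep R ρ μ).Equiv
          (Subrepresentation.mk (WeylModel.copolytab b μ) hC).toRepresentation)
      (ψ : (Subrepresentation.mk (WeylModel.copolytab b μ) hC).toRepresentation.Equiv
          ((WeylModel.symLowerRep R ρ μ).quotient (WeylModel.dualGarnir b μ) hD)),
      (∀ t : WeylModel.Tableau μ ι,
        ∃ θ : Module.Dual R (WeylModel.SymUpper R (Module.Dual R V) μ),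
          (∀ s : WeylModel.Tableau μ ι, θ (WeylModel.rowTabloid R (b.dualBasis ∘ s)) =
            if s ∈ WeylModel.rowOrbit t then 1 else 0) ∧
          (φ (θ.domRestrict (WeylModel.polytab R ρ.dual μ).toSubmodule) :
            WeylModel.ExtUpper R V μ) = WeylModel.copolytabloid R b t) ∧
      ∀ (t : WeylModel.Tableau μ ι) (x : WeylModel.copolytab b μ),
        (x : WeylModel.ExtUpper R V μ) = WeylModel.copolytabloid R b t →
          ψ x = Submodule.Quotient.mk (WeylModel.rowSym b t) := by
  refine ⟨fun g x hx => WeylModel.extUpperRep_mem_copolytab b ρ g hx,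
    fun g => WeylModel.dualGarnir_le_comap b ρ g,
    .mk (WeylModel.weylEquivCopolytab μ b ρ) fun g => LinearMap.ext fun F =>
      WeylModel.weylEquivCopolytab_weylRep b ρ g F,
    .symm (.mk (WeylModel.quotientEquivCopolytab μ b) fun g => LinearMap.ext fun q => ?_),
    fun t => ⟨WeylModel.rowFunctional b t,
      WeylModel.rowFunctional_rowTabloid_dualBasis b (t := t), ?_⟩, fun t x hx => ?_⟩
  · obtain ⟨w, rfl⟩ := Submodule.Quotient.mk_surjective _ q
    refine (WeylModel.quotientEquivCopolytab_mk b (WeylModel.symLowerRep R ρ μ g w)).trans ?_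
    rw [LinearMap.comp_apply, LinearEquiv.coe_coe, WeylModel.quotientEquivCopolytab_mk]
    exact Subtype.ext (WeylModel.extUpperRep_symProj ρ g w).symm
  · have hmem : WeylModel.copolytabloid R b t ∈ WeylModel.copolytab b μ :=
      Submodule.subset_span ⟨t, rfl⟩
    refine congrArg Subtype.val (WeylModel.copolytab_ext b
      (x := WeylModel.weylEquivCopolytab μ b ρ _) (y := ⟨_, hmem⟩) fun f => ?_)
    rw [WeylModel.columnFunctional_weylEquivCopolytab]
    exact WeylModel.rowFunctional_polytabloid b t f
  · refine (WeylModel.quotientEquivCopolytab μ b).symm_apply_eq.2 (Subtype.ext ?_)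
    rw [WeylModel.quotientEquivCopolytab_mk, hx]
    exact (WeylModel.symProj_rowSym _ _).symm
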